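/- Let $\alpha,\beta,\gamma,\delta,t,q\in\mathbb C$ and $\epsilon\in\mathbb Z_{\le 0}$ with $\gamma+\delta+\epsilon=\alpha+\beta+1$ and $t\ne 0,1$, and consider Heun's differential equation $$\frac{d^2y}{dz^2}+\Big(\frac{\gamma}{z}+\frac{\delta}{z-1}+\frac{\epsilon}{z-t}\Big)\frac{dy}{dz}+\frac{\alpha\beta z-q}{z(z-1)(z-t)}\,y=0 .\qquad (*)$$ Assume that $\alpha,\ \beta,\ \beta-\gamma,\ \beta-\delta\notin\mathbb Z$ and that the singularity $z=t$ of $(*)$ is apparent, i.e. that there is a basis of local solutions near $t$ without a logarithmic term, of the form $f(z)=\sum_{j\ge0}c_j(z-t)^j$ with $c_0\ne0$ and $(z-t)^{1-\epsilon}\sum_{j\ge0}\tilde c_j(z-t)^j$ with $\tilde c_0\neq0$ (convergent power series). Then every solution of $(*)$ is a finite linear combination of Gauss hypergeometric functions. Precisely, let $F(a,b;c;z)$ (where $c\notin\mathbb Z_{\le0}$) denote the holomorphic function on $\mathbb C\setminus[1,\infty)$ that continues the hypergeometric series $\sum_{n\ge 0}\frac{(a)_n(b)_n}{(c)_n\,n!}z^n$,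 and let $\Omega=\mathbb C\setminus\big((-\infty,0]\cup[1,\infty)\big)$. There are finitely many functions $\varphi_1,\dots,\varphi_N$ on $\Omega$, each of one of the forms $$F(a,b;c;z),\quad z^{c-1}F(a,b;c;z),\quad F(a,b;c;1-z),\quad (1-z)^{c-1}F(a,b;c;1-z)$$ (with principal branches, and with $a,b,c\in\mathbb C$, $c\notin\mathbb Z_{\le0}$, depending on the function), such that for every connected open set $U\subseteq\Omega\setminus\{t\}$ and every holomorphic solution $y$ of $(*)$ on $U$ there are constants $C_1,\dots,C_N\in\mathbb C$ with $y(z)=\sum_{i=1}^N C_i\,\varphi_i(z)$ for all $z\in U$. -/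

import Mathlib

/-- The left-hand side of Heun's differential equation, at the point `z`:
`y'' + (γ/z + δ/(z-1) + ε/(z-t)) y' + (α β z - q)/(z (z-1) (z-t)) y`. -/
noncomputable def heunLHS (α β γ δ ε t q : ℂ) (y : ℂ → ℂ) (z : ℂ) : ℂ :=
  deriv (deriv y) z + (γ / z + δ / (z - 1) + ε / (z - t)) * deriv y z
    + (α * β * z - q) / (z * (z - 1) * (z - t)) * y z

/-- The function `y` is holomorphic on `U` and solves Heun's equation there
(`U` is meant to be an open set that contains none of `0`, `1`, `t`). -/
def IsHeunSolutionOn (α β γ δ ε t q : ℂ) (U : Set ℂ) (y : ℂ → ℂ) : Prop :=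
  DifferentiableOn ℂ y U ∧ ∀ z ∈ U, heunLHS α β γ δ ε t q y z = 0

/-- For an integer `ε ≤ 0`, the singularity `z = t` of Heun's equation, whose exponents are `0` and
`1 - ε`, is apparent: there is a basis of local solutions without a logarithmic term, that is
`f z = ∑ c j (z-t)^j` with `c 0 ≠ 0`, and `(z-t)^(1-ε) * g z` with `g z = ∑ c' j (z-t)^j` and
`c' 0 ≠ 0`, where both power series converge near `t`. -/
def HeunApparentAt (α β γ δ : ℂ) (ε : ℤ) (t q : ℂ) : Prop :=
  ∃ f g : ℂ → ℂ,
    AnalyticAt ℂ f t ∧ f t ≠ 0 ∧ AnalyticAt ℂ g t ∧ g t ≠ 0 ∧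
    (∀ᶠ z in nhdsWithin t {t}ᶜ, heunLHS α β γ δ ε t q f z = 0) ∧
    (∀ᶠ z in nhdsWithin t {t}ᶜ,
      heunLHS α β γ δ ε t q (fun w => (w - t) ^ (1 - ε) * g w) z = 0)

/-- The plane without the cut `[1, ∞)`. -/
def gaussDomain : Set ℂ := {z | 1 - z ∈ Complex.slitPlane}

/-- The plane without the two cuts `(-∞, 0]` and `[1, ∞)`. -/
def doublySlitPlane : Set ℂ := {z | z ∈ Complex.slitPlane ∧ 1 - z ∈ Complex.slitPlane}

/-- `F` is (on the plane cut along `[1, ∞)`) the Gauss hypergeometric function `F(a, b; c; z)`: the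
parameter `c` is not a non-positive integer, `F` is holomorphic on the cut plane, and in the unit
disc it is the sum of the hypergeometric series. -/
def IsGaussHypergeometric (a b c : ℂ) (F : ℂ → ℂ) : Prop :=
  (∀ n : ℕ, c ≠ -(n : ℂ)) ∧ DifferentiableOn ℂ F gaussDomain ∧
    ∀ z : ℂ, ‖z‖ < 1 → F z = ordinaryHypergeometric a b c z

/-- On the doubly slit plane, `φ` is one of the hypergeometric functions
`F(a, b; c; z)`, `z^(c-1) F(a, b; c; z)`, `F(a, b; c; 1-z)`, `(1-z)^(c-1) F(a, b; c; 1-z)`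
(principal branches): these are the standard solutions, at the points `0` and `1`, of the
hypergeometric differential equations. -/
def IsHypergeometricSolution (φ : ℂ → ℂ) : Prop :=
  ∃ (a b c : ℂ) (F : ℂ → ℂ), IsGaussHypergeometric a b c F ∧
    ((∀ z ∈ doublySlitPlane, φ z = F z) ∨
     (∀ z ∈ doublySlitPlane, φ z = z ^ (c - 1) * F z) ∨
     (∀ z ∈ doublySlitPlane, φ z = F (1 - z)) ∨
     (∀ z ∈ doublySlitPlane, φ z = (1 - z) ^ (c - 1) * F (1 - z)))

/-!
A solution that is holomorphic and nonzero at the apparent singularity `t` makes the finite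
tridiagonal matrix, by which Heun's operator acts on Taylor coefficients at `t` up to the order
`-ε`, singular. A left null vector of this matrix is a functional on jets at `t` that kills the
range of Heun's operator. Its value at `zⁿ` is `tⁿ P n` with a nonzero polynomial `P`, and the
vanishing of the functional on Heun's operator applied to `zⁿ` is a recurrence for `P`. It is the
recurrence needed for the numbers `P n * aₙ` to be the Taylor coefficients at `0` of a solution of
Heun's equation, whenever the `aₙ` are those of a solution of the hypergeometric equation with
parameters `α`, `β`, `γ`. Expanding `P` in shifted rising factorials turns this solution into a
finite combination of hypergeometric functions with contiguous parameters.

The solution obtained in this way is holomorphic on the plane cut along `[1, ∞)`. The reflection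
`z ↦ 1 - z` gives another one, holomorphic on the plane cut along `(-∞, 0]`. Their Taylor series
have radius of convergence `1`, so neither extends to an entire function. Since the two cut planes
cover `ℂ`, the two solutions are linearly independent, hence a basis of the solutions.

The continuation of the hypergeometric series comes from the Koebe function `w ↦ 4w / (1 + w)²`,
which maps the unit disc onto the plane cut along `[1, ∞)` and pulls the hypergeometric equation
back to one without singularities in the punctured disc.
-/

open Filter Topology Polynomial

section TaylorCoefficients

open FormalMultilinearSeries

variable {𝕜 : Type*} [NontriviallyNormedField 𝕜] {f g : 𝕜 → 𝕜} {a b : ℕ → 𝕜} {c : 𝕜}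

/-- `f` is near `c` the sum of the power series `∑ a n (z - c) ^ n`. This is `HasFPowerSeriesAt`
for a series given by its scalar coefficients, on which recurrences can be stated. -/
def HasTaylorCoeffsAt (f : 𝕜 → 𝕜) (a : ℕ → 𝕜) (c : 𝕜) : Prop :=
  HasFPowerSeriesAt f (ofScalars 𝕜 a) c

/-- The coefficients of `(z - c) ^ m * f z`, if `a` are those of `f` at `c`. -/
def shiftRight (m : ℕ) : (ℕ → 𝕜) →ₗ[𝕜] (ℕ → 𝕜) where
  toFun a n := if n < m then 0 else a (n - m)
  map_add' a b := by ext n; by_cases h : n < m <;> simp [h]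
  map_smul' k a := by ext n; by_cases h : n < m <;> simp [h]

theorem shiftRight_of_lt {m n : ℕ} (h : n < m) (a : ℕ → 𝕜) : shiftRight m a n = 0 :=
  if_pos h

@[simp]
theorem shiftRight_add (m n : ℕ) (a : ℕ → 𝕜) : shiftRight m a (n + m) = a n := by
  simp [shiftRight]

namespace HasTaylorCoeffsAt

theorem iff_hasSum : HasTaylorCoeffsAt f a c ↔
    ∀ᶠ z in 𝓝 0, HasSum (fun n => z ^ n * a n) (f (c + z)) := by
  rw [HasTaylorCoeffsAt, hasFPowerSeriesAt_iff]
  simp only [coeff_ofScalars, smul_eq_mul]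

theorem analyticAt (h : HasTaylorCoeffsAt f a c) : AnalyticAt 𝕜 f c := ⟨_, h⟩

theorem unique (h : HasTaylorCoeffsAt f a c) (h' : HasTaylorCoeffsAt f b c) : a = b :=
  ofScalars_series_injective 𝕜 𝕜 (HasFPowerSeriesAt.eq_formalMultilinearSeries h h')

theorem congr (h : HasTaylorCoeffsAt f a c) (hfg : f =ᶠ[𝓝 c] g) : HasTaylorCoeffsAt g a c :=
  HasFPowerSeriesAt.congr h hfg

theorem zero : HasTaylorCoeffsAt (fun _ => (0 : 𝕜)) 0 c := by
  rw [iff_hasSum]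
  exact Eventually.of_forall fun z => by simp

theorem add (h : HasTaylorCoeffsAt f a c) (h' : HasTaylorCoeffsAt g b c) :
    HasTaylorCoeffsAt (f + g) (a + b) c := by
  rw [iff_hasSum] at *
  filter_upwards [h, h'] with z hz hz'
  simpa [mul_add] using hz.add hz'

theorem const_smul (k : 𝕜) (h : HasTaylorCoeffsAt f a c) :
    HasTaylorCoeffsAt (k • f) (k • a) c := by
  rw [iff_hasSum] at *
  filter_upwards [h] with z hz
  simpa [mul_left_comm] using hz.mul_left k

theorem apply_center (h : HasTaylorCoeffsAt f a c) : f c = a 0 := by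
  simpa using (HasFPowerSeriesAt.coeff_zero h fun _ => 0).symm

theorem sub_pow_mul (m : ℕ) (h : HasTaylorCoeffsAt f a c) :
    HasTaylorCoeffsAt (fun z => (z - c) ^ m * f z) (shiftRight m a) c := by
  rw [iff_hasSum] at *
  filter_upwards [h] with z hz
  have hlow : ∑ n ∈ Finset.range m, z ^ n * shiftRight m a n = 0 :=
    Finset.sum_eq_zero fun n hn => by rw [shiftRight_of_lt (Finset.mem_range.1 hn), mul_zero]
  rw [← hasSum_nat_add_iff' m, hlow]
  simpa [pow_add, mul_assoc, mul_left_comm] using hz.mul_left (z ^ m)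

theorem eventuallyEq (h : HasTaylorCoeffsAt f a c) (h' : HasTaylorCoeffsAt g a c) :
    f =ᶠ[𝓝 c] g := by
  have hsub := HasFPowerSeriesAt.sub h h'
  rw [sub_self] at hsub
  exact hsub.eventually_eq_zero.mono fun _ => sub_eq_zero.1

theorem eventually_eq_zero_iff (h : HasTaylorCoeffsAt f a c) :
    (∀ᶠ z in 𝓝 c, f z = 0) ↔ a = 0 :=
  ⟨fun h0 => (h.congr h0).unique zero, fun ha => h.eventuallyEq (ha ▸ zero)⟩

section Complete

variable [CompleteSpace 𝕜]

theorem of_analyticAt [CharZero 𝕜] (h : AnalyticAt 𝕜 f c) :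
    HasTaylorCoeffsAt f (fun n => iteratedDeriv n f c / n.factorial) c :=
  h.hasFPowerSeriesAt

theorem deriv [CharZero 𝕜] (h : HasTaylorCoeffsAt f a c) :
    HasTaylorCoeffsAt (deriv f) (fun n => (n + 1) * a (n + 1)) c := by
  convert of_analyticAt h.analyticAt.deriv using 2 with n
  simp only [h.unique (of_analyticAt h.analyticAt), ← iteratedDeriv_succ', Nat.factorial_succ]
  have : (n.factorial : 𝕜) ≠ 0 := by exact_mod_cast n.factorial_ne_zero
  have : (n + 1 : 𝕜) ≠ 0 := by exact_mod_cast n.succ_ne_zero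
  push_cast
  field_simp

theorem exists_of_bound (h : ∀ ρ : NNReal, ρ < 1 → ∃ C : ℝ, ∀ n, ‖a n‖ * (ρ : ℝ) ^ n ≤ C)
    (c : 𝕜) :
    ∃ G : 𝕜 → 𝕜, DifferentiableOn 𝕜 G (Metric.ball c 1) ∧ HasTaylorCoeffsAt G a c := by
  have hr : 1 ≤ (ofScalars 𝕜 a).radius := by
    refine ENNReal.le_of_forall_nnreal_lt fun ρ hρ => ?_
    obtain ⟨C, hC⟩ := h ρ (by exact_mod_cast hρ)
    exact le_radius_of_bound _ C fun n => by rw [ofScalars_norm]; exact hC n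
  have hG := (((ofScalars 𝕜 a).hasFPowerSeriesOnBall (one_pos.trans_le hr)).comp_sub c).mono
    one_pos hr
  rw [zero_add] at hG
  refine ⟨_, ?_, hG.hasFPowerSeriesAt⟩
  simpa [← ENNReal.ofReal_one, Metric.eball_ofReal] using hG.differentiableOn

end Complete

theorem hasSum_of_differentiableOn {f : ℂ → ℂ} {a : ℕ → ℂ} {c : ℂ} {r : ℝ}
    (h : HasTaylorCoeffsAt f a c) (hf : DifferentiableOn ℂ f (Metric.ball c r)) {z : ℂ}
    (hz : z ∈ Metric.ball c r) : HasSum (fun n => (z - c) ^ n * a n) (f z) := by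
  rw [h.unique (of_analyticAt h.analyticAt)]
  refine (Complex.hasSum_taylorSeries_on_ball hf hz).congr_fun fun n => ?_
  simp only [smul_eq_mul]
  ring

end HasTaylorCoeffsAt

end TaylorCoefficients

section ThreeTermOperators

variable {𝕜 : Type*}

/-- The coefficients of a differential operator `(p₃w³ + p₂w² + p₁w)∂² + (r₂w² + r₁w + r₀)∂ +
(s₁w + s₀)` in a local coordinate `w = z - c`. These are the second order operators which act on
power series in `w` by a three term expression in the coefficients. -/
structure ThreeTermOperator (𝕜 : Type*) where
  (p₃ p₂ p₁ r₂ r₁ r₀ s₁ s₀ : 𝕜)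

namespace ThreeTermOperator

/-- The action of the operator with local coordinate `z - c` on functions. -/
noncomputable def apply [NontriviallyNormedField 𝕜] (D : ThreeTermOperator 𝕜) (c : 𝕜) (f : 𝕜 → 𝕜)
    (z : 𝕜) : 𝕜 :=
  (D.p₃ * (z - c) ^ 3 + D.p₂ * (z - c) ^ 2 + D.p₁ * (z - c)) * deriv (deriv f) z
    + (D.r₂ * (z - c) ^ 2 + D.r₁ * (z - c) + D.r₀) * deriv f z + (D.s₁ * (z - c) + D.s₀) * f z

theorem apply_sub_pow [NontriviallyNormedField 𝕜] (D : ThreeTermOperator 𝕜) (c : 𝕜) (n : ℕ)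
    (z : 𝕜) : D.apply c (fun z => (z - c) ^ n) z =
      (n * (n - 1) * D.p₃ + n * D.r₂ + D.s₁) * (z - c) ^ (n + 1) +
      (n * (n - 1) * D.p₂ + n * D.r₁ + D.s₀) * (z - c) ^ n +
      n * ((n - 1) * D.p₁ + D.r₀) * (z - c) ^ (n - 1) := by
  have hderiv : ∀ m : ℕ, deriv (fun z => (z - c) ^ m) = fun z => m * (z - c) ^ (m - 1) := by
    intro m
    funext z
    simp
  simp only [apply, hderiv, deriv_const_mul_field]
  rcases n with _ | _ | n
  · simp
  · simp only [zero_add, Nat.cast_one, sub_self, tsub_self, pow_zero, mul_one]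
    ring
  · push_cast [Nat.add_sub_cancel]
    ring

/-- The action of the operator on sequences of power series coefficients. -/
def coeff [NontriviallyNormedField 𝕜] (D : ThreeTermOperator 𝕜) : (ℕ → 𝕜) →ₗ[𝕜] (ℕ → 𝕜) where
  toFun a n := (n + 1) * (n * D.p₁ + D.r₀) * a (n + 1) +
    (n * (n - 1) * D.p₂ + n * D.r₁ + D.s₀) * a n +
    ((n - 1) * (n - 2) * D.p₃ + (n - 1) * D.r₂ + D.s₁) * shiftRight 1 a n
  map_add' a b := by ext n; simp only [map_add, Pi.add_apply]; ring
  map_smul' k a := by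
    ext n
    simp only [map_smul, Pi.smul_apply, smul_eq_mul, RingHom.id_apply]
    ring

section Field

variable [NontriviallyNormedField 𝕜] (D : ThreeTermOperator 𝕜)

theorem coeff_zero (a : ℕ → 𝕜) : D.coeff a 0 = D.r₀ * a 1 + D.s₀ * a 0 := by
  simp [coeff, shiftRight_of_lt]

theorem coeff_succ (a : ℕ → 𝕜) (n : ℕ) : D.coeff a (n + 1) =
    (n + 2) * ((n + 1) * D.p₁ + D.r₀) * a (n + 2) +
      ((n + 1) * n * D.p₂ + (n + 1) * D.r₁ + D.s₀) * a (n + 1) +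
      (n * (n - 1) * D.p₃ + n * D.r₂ + D.s₁) * a n := by
  simp only [coeff, LinearMap.coe_mk, AddHom.coe_mk, shiftRight_add]
  push_cast
  ring

theorem _root_.HasTaylorCoeffsAt.apply [CompleteSpace 𝕜] [CharZero 𝕜] {f : 𝕜 → 𝕜} {a : ℕ → 𝕜}
    {c : 𝕜} (h : HasTaylorCoeffsAt f a c) :
    HasTaylorCoeffsAt (D.apply c f) (D.coeff a) c := by
  have h₁ := h.deriv
  have h₂ := h₁.deriv
  convert ((((h₂.sub_pow_mul 3).const_smul D.p₃).add ((h₂.sub_pow_mul 2).const_smul D.p₂)).add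
    ((h₂.sub_pow_mul 1).const_smul D.p₁)).add ((((h₁.sub_pow_mul 2).const_smul D.r₂).add
    ((h₁.sub_pow_mul 1).const_smul D.r₁)).add (h₁.const_smul D.r₀)) |>.add
    (((h.sub_pow_mul 1).const_smul D.s₁).add (h.const_smul D.s₀)) using 1
  · funext z
    simp only [ThreeTermOperator.apply, Pi.add_apply, Pi.smul_apply, smul_eq_mul]
    ring
  · funext n
    rcases n with _ | _ | _ | n <;> simp [coeff, shiftRight, add_assoc] <;> ring

theorem analyticAt_apply [CompleteSpace 𝕜] [CharZero 𝕜] {f : 𝕜 → 𝕜} {c z : 𝕜}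
    (h : AnalyticAt 𝕜 f z) : AnalyticAt 𝕜 (D.apply c f) z := by
  have h₁ := h.deriv
  have := h₁.deriv
  unfold ThreeTermOperator.apply
  fun_prop

theorem eventually_apply_eq_zero_iff [CompleteSpace 𝕜] [CharZero 𝕜] {f : 𝕜 → 𝕜} {a : ℕ → 𝕜}
    {c : 𝕜} (h : HasTaylorCoeffsAt f a c) :
    (∀ᶠ z in 𝓝 c, D.apply c f z = 0) ↔ D.coeff a = 0 :=
  (h.apply D).eventually_eq_zero_iff

theorem coeff_congr {M n : ℕ} {a b : ℕ → 𝕜} (hM : M * D.p₁ + D.r₀ = 0)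
    (h : ∀ j ≤ M, a j = b j) (hn : n ≤ M) : D.coeff a n = D.coeff b n := by
  have hnext : (n * D.p₁ + D.r₀) * a (n + 1) = (n * D.p₁ + D.r₀) * b (n + 1) := by
    rcases hn.lt_or_eq with hlt | rfl
    · rw [h (n + 1) hlt]
    · rw [hM, zero_mul, zero_mul]
  have hprev : shiftRight 1 a n = shiftRight 1 b n := by
    rcases n with _ | n
    · rw [shiftRight_of_lt one_pos, shiftRight_of_lt one_pos]
    · rw [shiftRight_add, shiftRight_add, h n (by omega)]
  simp only [coeff, LinearMap.coe_mk, AddHom.coe_mk, h n hn, hprev, mul_assoc _ _ (a (n + 1)),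
    mul_assoc _ _ (b (n + 1)), hnext]

theorem coeff_eq_sum_coeff_single {M n : ℕ} (hM : M * D.p₁ + D.r₀ = 0) (b : ℕ → 𝕜) (hn : n ≤ M) :
    D.coeff b n = ∑ j : Fin (M + 1), D.coeff (Pi.single (j : ℕ) 1) n * b j := by
  have htrunc : ∀ i ≤ M, b i = (∑ j : Fin (M + 1), b j • Pi.single (j : ℕ) (1 : 𝕜)) i := by
    intro i hi
    rw [Finset.sum_apply, Finset.sum_eq_single ⟨i, Nat.lt_succ_of_le hi⟩]
    · simp
    · intro j _ hj
      have : i ≠ j := fun h => hj (Fin.ext h.symm)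
      simp [this]
    · simp
  rw [D.coeff_congr hM htrunc hn, map_sum, Finset.sum_apply]
  simp only [map_smul, Pi.smul_apply, smul_eq_mul, mul_comm]

/-- The exponents of `D` are `0` and `M + 1`, so the coefficients up to the order `M` of `D f`
depend only on those of `f`. A solution makes this square matrix singular, and a left null vector
gives a functional on jets which kills the range of `D`. -/
theorem exists_functional_of_coeff_eq_zero {M : ℕ} {a : ℕ → 𝕜} (hM : M * D.p₁ + D.r₀ = 0)
    (ha0 : a 0 ≠ 0) (ha : D.coeff a = 0) :
    ∃ l : Fin (M + 1) → 𝕜, l ≠ 0 ∧ ∀ b, ∑ j, l j * D.coeff b j = 0 := by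
  let A : Matrix (Fin (M + 1)) (Fin (M + 1)) 𝕜 := fun i j => D.coeff (Pi.single (j : ℕ) 1) i
  have hA : ∀ b (i : Fin (M + 1)), D.coeff b i = A.mulVec (fun j => b j) i := fun b i =>
    D.coeff_eq_sum_coeff_single hM b (Nat.le_of_lt_succ i.2)
  have hdet : A.det = 0 := Matrix.exists_mulVec_eq_zero_iff.1
    ⟨fun j => a j, fun h => ha0 (congrFun h 0), funext fun i => by rw [← hA, ha]; rfl⟩
  obtain ⟨l, hl, hlA⟩ := Matrix.exists_vecMul_eq_zero_iff.2 hdet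
  refine ⟨l, hl, fun b => ?_⟩
  calc ∑ j, l j * D.coeff b j = l ⬝ᵥ A.mulVec fun j => b j := by simp only [hA, dotProduct]
    _ = 0 := by rw [Matrix.dotProduct_mulVec, hlA, zero_dotProduct]

end Field

end ThreeTermOperator

end ThreeTermOperators

theorem exists_bound_of_recurrence {R : Type*} [SeminormedRing R] {k u v : ℕ → R} {u₀ v₀ : R}
    (hu : Tendsto u atTop (𝓝 u₀)) (hv : Tendsto v atTop (𝓝 v₀))
    (h : ∀ n, k (n + 2) = u n * k (n + 1) + v n * k n) {ρ : ℝ} (hρ : 0 ≤ ρ)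
    (hlt : ‖u₀‖ * ρ + ‖v₀‖ * ρ ^ 2 < 1) : ∃ C : ℝ, ∀ n, ‖k n‖ * ρ ^ n ≤ C := by
  have hlim := (hu.norm.mul_const ρ).add (hv.norm.mul_const (ρ ^ 2))
  obtain ⟨N, hN⟩ := eventually_atTop.1 (hlim.eventually (gt_mem_nhds hlt))
  have hpos : ∀ n, 0 ≤ ‖k n‖ * ρ ^ n := fun n => by positivity
  set C := ∑ i ∈ Finset.range (N + 2), ‖k i‖ * ρ ^ i
  have hC : 0 ≤ C := Finset.sum_nonneg fun i _ => hpos i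
  refine ⟨C, fun n => ?_⟩
  induction n using Nat.strong_induction_on with
  | _ n ih =>
    by_cases hn : n < N + 2
    · exact Finset.single_le_sum (f := fun i => ‖k i‖ * ρ ^ i) (fun i _ => hpos i)
        (Finset.mem_range.2 hn)
    · obtain ⟨m, rfl⟩ : ∃ m, n = m + 2 := ⟨n - 2, by omega⟩
      have ih₁ := ih (m + 1) (by omega)
      have ih₀ := ih m (by omega)
      have hm := hN m (by omega)
      calc ‖k (m + 2)‖ * ρ ^ (m + 2)
          ≤ (‖u m‖ * ‖k (m + 1)‖ + ‖v m‖ * ‖k m‖) * ρ ^ (m + 2) := by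
            gcongr
            rw [h]
            exact (norm_add_le _ _).trans (add_le_add (norm_mul_le _ _) (norm_mul_le _ _))
        _ = ‖u m‖ * ρ * (‖k (m + 1)‖ * ρ ^ (m + 1)) + ‖v m‖ * ρ ^ 2 * (‖k m‖ * ρ ^ m) := by ring
        _ ≤ ‖u m‖ * ρ * C + ‖v m‖ * ρ ^ 2 * C := by gcongr
        _ = (‖u m‖ * ρ + ‖v m‖ * ρ ^ 2) * C := by ring
        _ ≤ C := mul_le_of_le_one_left hC hm.le

section GaussHypergeometric

theorem isOpen_gaussDomain : IsOpen gaussDomain :=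
  Complex.isOpen_slitPlane.preimage (f := fun z : ℂ => 1 - z) (by fun_prop)

theorem one_add_mem_slitPlane {z : ℂ} (hz : z ∈ Metric.ball (0 : ℂ) 1) :
    1 + z ∈ Complex.slitPlane :=
  Complex.mem_slitPlane_of_norm_lt_one (mem_ball_zero_iff.1 hz)

theorem ball_subset_gaussDomain : Metric.ball (0 : ℂ) 1 ⊆ gaussDomain := fun z hz => by
  simpa [gaussDomain, sub_eq_add_neg] using one_add_mem_slitPlane (z := -z) (by simpa using hz)

theorem gaussDomain_mem_nhds_zero : gaussDomain ∈ 𝓝 (0 : ℂ) :=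
  mem_of_superset (Metric.ball_mem_nhds 0 one_pos) ball_subset_gaussDomain

theorem add_natCast_ne_zero {R : Type*} [Ring R] {c : R} (hc : ∀ n : ℕ, c ≠ -(n : R)) (n : ℕ) :
    c + n ≠ 0 :=
  fun h => hc n (eq_neg_of_add_eq_zero_left h)

/-- The hypergeometric operator `z(1 - z)∂² + (c - (a + b + 1)z)∂ - ab`, at the base point `0`. -/
def hypergeometricOperator {𝕜 : Type*} [Field 𝕜] (a b c : 𝕜) : ThreeTermOperator 𝕜 where
  p₃ := 0
  p₂ := -1
  p₁ := 1
  r₂ := 0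
  r₁ := -(a + b + 1)
  r₀ := c
  s₁ := 0
  s₀ := -(a * b)

theorem hypergeometricOperator_coeff {𝕜 : Type*} [NontriviallyNormedField 𝕜] (a b c : 𝕜)
    (g : ℕ → 𝕜) (n : ℕ) : (hypergeometricOperator a b c).coeff g n =
      (n + 1) * (n + c) * g (n + 1) - (n + a) * (n + b) * g n := by
  simp only [ThreeTermOperator.coeff, hypergeometricOperator, LinearMap.coe_mk, AddHom.coe_mk]
  ring

theorem hypergeometricOperator_coeff_ordinaryHypergeometricCoefficient {𝕜 : Type*}
    [NontriviallyNormedField 𝕜] [CharZero 𝕜] (a b : 𝕜) {c : 𝕜} (hc : ∀ n : ℕ, c ≠ -(n : 𝕜)) :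
    (hypergeometricOperator a b c).coeff (ordinaryHypergeometricCoefficient a b c) = 0 := by
  ext n
  have hcn := add_natCast_ne_zero hc n
  have hn : (n + 1 : 𝕜) ≠ 0 := by exact_mod_cast n.succ_ne_zero
  rw [hypergeometricOperator_coeff, Pi.zero_apply]
  simp only [ordinaryHypergeometricCoefficient, ascPochhammer_succ_eval, Nat.factorial_succ,
    Nat.cast_mul, Nat.cast_succ, mul_inv]
  field_simp
  ring

theorem radius_ordinaryHypergeometricSeries_pos (a b c : ℂ) :
    0 < (ordinaryHypergeometricSeries ℂ a b c).radius := by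
  by_cases h : ∀ k : ℕ, (k : ℂ) ≠ -a ∧ (k : ℂ) ≠ -b ∧ (k : ℂ) ≠ -c
  · rw [ordinaryHypergeometricSeries_radius_eq_one ℂ a b c h]
    exact one_pos
  · simp only [not_forall, not_and_or, not_not, ← neg_eq_iff_eq_neg] at h
    obtain ⟨k, rfl | rfl | rfl⟩ := h
    · simp [ordinaryHypergeometric_radius_top_of_neg_nat₁]
    · simp [ordinaryHypergeometric_radius_top_of_neg_nat₂]
    · simp [ordinaryHypergeometric_radius_top_of_neg_nat₃]

theorem hasTaylorCoeffsAt_ordinaryHypergeometric (a b c : ℂ) :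
    HasTaylorCoeffsAt (ordinaryHypergeometric a b c) (ordinaryHypergeometricCoefficient a b c)
      (0 : ℂ) :=
  ((ordinaryHypergeometricSeries ℂ a b c).hasFPowerSeriesOnBall
    (radius_ordinaryHypergeometricSeries_pos a b c)).hasFPowerSeriesAt

theorem IsGaussHypergeometric.of_hasTaylorCoeffsAt {a b c : ℂ} {F : ℂ → ℂ}
    (hc : ∀ n : ℕ, c ≠ -(n : ℂ)) (hF : DifferentiableOn ℂ F gaussDomain)
    (h : HasTaylorCoeffsAt F (ordinaryHypergeometricCoefficient a b c) 0) :
    IsGaussHypergeometric a b c F := by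
  refine ⟨hc, hF, fun z hz => ?_⟩
  have hsum := h.hasSum_of_differentiableOn (hF.mono ball_subset_gaussDomain)
    (mem_ball_zero_iff.2 hz)
  rw [← hsum.tsum_eq, ordinaryHypergeometric_eq_tsum]
  exact tsum_congr fun n => by rw [sub_zero, smul_eq_mul, mul_comm]

/-- The rational function `4w / (1 + w)²`, which maps the unit disc conformally onto the plane cut
along `[1, ∞)`. -/
noncomputable def koebeMap (w : ℂ) : ℂ := 4 * w / (1 + w) ^ 2

/-- The pullback of `G` along `koebeMap`, multiplied by `(1 + w) ^ (-2a)`. With this factor the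
pullback of the hypergeometric operator is again a three term operator, whose only singularities
besides `0` and `∞` are `±1`. -/
noncomputable def koebePullback (a : ℂ) (G : ℂ → ℂ) (w : ℂ) : ℂ :=
  (1 + w) ^ (-2 * a) * G (koebeMap w)

/-- The operator of which `koebePullback a G` is a solution if `G` solves the hypergeometric
equation with parameters `a`, `b`, `c`. -/
def koebeOperator (a b c : ℂ) : ThreeTermOperator ℂ where
  p₃ := 1
  p₂ := 0
  p₁ := -1
  r₂ := 2 + 4 * a - c
  r₁ := 4 * b - 2 * c
  r₀ := -c
  s₁ := 2 * a * (2 * a + 1 - c)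
  s₀ := 4 * a * b - 2 * a * c

theorem hasDerivAt_koebeMap {w : ℂ} (hw : 1 + w ≠ 0) :
    HasDerivAt koebeMap (4 * (1 - w) / (1 + w) ^ 3) w := by
  have hlin : HasDerivAt (fun w : ℂ => 1 + w) 1 w := (hasDerivAt_id w).const_add 1
  refine (((hasDerivAt_id w).const_mul 4).fun_div (hlin.fun_pow 2)
    (pow_ne_zero 2 hw)).congr_deriv ?_
  simp only [id, Nat.cast_ofNat]
  field_simp
  ring

theorem hasDerivAt_deriv_koebeMap {w : ℂ} (hw : 1 + w ≠ 0) :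
    HasDerivAt (fun w : ℂ => 4 * (1 - w) / (1 + w) ^ 3) ((8 * w - 16) / (1 + w) ^ 4) w := by
  have hlin : HasDerivAt (fun w : ℂ => 1 + w) 1 w := (hasDerivAt_id w).const_add 1
  refine ((((hasDerivAt_id w).const_sub 1).const_mul 4).fun_div (hlin.fun_pow 3)
    (pow_ne_zero 3 hw)).congr_deriv ?_
  simp only [id, Nat.cast_ofNat]
  field_simp
  ring

theorem hasDerivAt_koebePullback (a : ℂ) {G : ℂ → ℂ} {w : ℂ} (hw : 1 + w ∈ Complex.slitPlane)
    (hG : DifferentiableAt ℂ G (koebeMap w)) :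
    HasDerivAt (koebePullback a G) (4 * (1 - w) / (1 + w) ^ 3 * koebePullback a (deriv G) w
      - 2 * a / (1 + w) * koebePullback a G w) w := by
  have hw0 := Complex.slitPlane_ne_zero hw
  have hlin : HasDerivAt (fun w : ℂ => 1 + w) 1 w := (hasDerivAt_id w).const_add 1
  refine ((hlin.cpow_const (c := -2 * a) hw).fun_mul
    (hG.hasDerivAt.comp w (hasDerivAt_koebeMap hw0))).congr_deriv ?_
  simp only [koebePullback, Function.comp, Complex.cpow_sub _ _ hw0, Complex.cpow_one]
  field_simp
  ring

theorem deriv_deriv_koebePullback (a : ℂ) {G : ℂ → ℂ} {w : ℂ} (hw : 1 + w ∈ Complex.slitPlane)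
    (hG : AnalyticAt ℂ G (koebeMap w)) :
    deriv (deriv (koebePullback a G)) w =
      (8 * w - 16) / (1 + w) ^ 4 * koebePullback a (deriv G) w
      + 4 * (1 - w) / (1 + w) ^ 3 * (4 * (1 - w) / (1 + w) ^ 3 * koebePullback a (deriv (deriv G)) w
        - 2 * a / (1 + w) * koebePullback a (deriv G) w)
      + 2 * a / (1 + w) ^ 2 * koebePullback a G w
      - 2 * a / (1 + w) * (4 * (1 - w) / (1 + w) ^ 3 * koebePullback a (deriv G) w
        - 2 * a / (1 + w) * koebePullback a G w) := by
  have hw0 := Complex.slitPlane_ne_zero hw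
  have hslit : ∀ᶠ v in 𝓝 w, 1 + v ∈ Complex.slitPlane :=
    ContinuousAt.eventually_mem (f := fun v : ℂ => 1 + v) (by fun_prop)
      (Complex.isOpen_slitPlane.mem_nhds hw)
  have hana := (hasDerivAt_koebeMap hw0).continuousAt.eventually hG.eventually_analyticAt
  have hderiv : deriv (koebePullback a G) =ᶠ[𝓝 w] fun v =>
      4 * (1 - v) / (1 + v) ^ 3 * koebePullback a (deriv G) v
        - 2 * a / (1 + v) * koebePullback a G v := by
    filter_upwards [hslit, hana] with v hv hGv
    exact (hasDerivAt_koebePullback a hv hGv.differentiableAt).deriv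
  have hlin : HasDerivAt (fun w : ℂ => 1 + w) 1 w := (hasDerivAt_id w).const_add 1
  rw [hderiv.deriv_eq, (((hasDerivAt_deriv_koebeMap hw0).fun_mul
    (hasDerivAt_koebePullback a hw hG.deriv.differentiableAt)).fun_sub
    (((hasDerivAt_const w (2 * a)).fun_div hlin hw0).fun_mul
      (hasDerivAt_koebePullback a hw hG.differentiableAt))).deriv]
  ring

theorem koebeOperator_apply_koebePullback (a b c : ℂ) {G : ℂ → ℂ} {w : ℂ}
    (hw : 1 + w ∈ Complex.slitPlane) (hG : AnalyticAt ℂ G (koebeMap w)) :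
    (koebeOperator a b c).apply 0 (koebePullback a G) w =
      -(4 * (1 - w) / (1 + w)) * koebePullback a ((hypergeometricOperator a b c).apply 0 G) w := by
  have hw0 := Complex.slitPlane_ne_zero hw
  simp only [ThreeTermOperator.apply, deriv_deriv_koebePullback a hw hG,
    (hasDerivAt_koebePullback a hw hG.differentiableAt).deriv, koebePullback, koebeOperator,
    hypergeometricOperator, koebeMap]
  field_simp
  ring

theorem analyticAt_koebePullback (a : ℂ) {G : ℂ → ℂ} (hG : AnalyticAt ℂ G 0) :
    AnalyticAt ℂ (koebePullback a G) 0 := by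
  have hmap : AnalyticAt ℂ koebeMap 0 := AnalyticAt.fun_div (by fun_prop) (by fun_prop) (by simp)
  exact AnalyticAt.fun_mul (AnalyticAt.cpow (by fun_prop) (by fun_prop) (by simp))
    (AnalyticAt.fun_comp (by simpa [koebeMap] using hG) hmap)

theorem koebeOperator_coeff_eq_zero (a b : ℂ) {c : ℂ} (hc : ∀ n : ℕ, c ≠ -(n : ℂ)) {k : ℕ → ℂ}
    (hk : HasTaylorCoeffsAt (koebePullback a (ordinaryHypergeometric a b c)) k 0) :
    (koebeOperator a b c).coeff k = 0 := by
  have hF := hasTaylorCoeffsAt_ordinaryHypergeometric a b c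
  have hode := ((hypergeometricOperator a b c).eventually_apply_eq_zero_iff hF).2
    (hypergeometricOperator_coeff_ordinaryHypergeometricCoefficient a b hc)
  have hmap : Tendsto koebeMap (𝓝 0) (𝓝 0) := by
    simpa [koebeMap] using (hasDerivAt_koebeMap (w := 0) (by simp)).continuousAt.tendsto
  rw [← (koebeOperator a b c).eventually_apply_eq_zero_iff hk]
  filter_upwards [Metric.ball_mem_nhds (0 : ℂ) one_pos, hmap.eventually hode,
    hmap.eventually hF.analyticAt.eventually_analyticAt] with w hw hode hana
  rw [koebeOperator_apply_koebePullback a b c (one_add_mem_slitPlane hw) hana, koebePullback,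
    hode, mul_zero, mul_zero]

theorem tendsto_koebeOperator_ratio₁ (a b c : ℂ) :
    Tendsto (fun n : ℕ => ((n + 1) * (4 * b - 2 * c) + (4 * a * b - 2 * a * c)) /
      ((n + 2) * (n + 1 + c))) atTop (𝓝 0) := by
  have hlin := tendsto_add_mul_div_add_mul_atTop_nhds (4 * b - 2 * c + (4 * a * b - 2 * a * c))
    (c + 1) (4 * b - 2 * c) (one_ne_zero (α := ℂ))
  have hinv := tendsto_add_mul_div_add_mul_atTop_nhds 1 2 0 (one_ne_zero (α := ℂ))
  have hprod := hlin.mul hinv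
  rw [zero_div, mul_zero] at hprod
  refine hprod.congr fun n => ?_
  rw [div_mul_div_comm]
  ring

theorem tendsto_koebeOperator_ratio₀ (a c : ℂ) :
    Tendsto (fun n : ℕ => (2 * a + n) * (2 * a + 1 - c + n) / ((n + 2) * (n + 1 + c)))
      atTop (𝓝 1) := by
  have hprod := (tendsto_add_mul_div_add_mul_atTop_nhds (2 * a) (c + 1) 1
    (one_ne_zero (α := ℂ))).mul (tendsto_add_mul_div_add_mul_atTop_nhds (2 * a + 1 - c) 2 1
    (one_ne_zero (α := ℂ)))
  rw [div_one, mul_one] at hprod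
  refine hprod.congr fun n => ?_
  rw [div_mul_div_comm]
  ring

theorem exists_continuation_koebePullback (a b : ℂ) {c : ℂ} (hc : ∀ n : ℕ, c ≠ -(n : ℂ)) :
    ∃ K : ℂ → ℂ, DifferentiableOn ℂ K (Metric.ball 0 1) ∧
      K =ᶠ[𝓝 0] koebePullback a (ordinaryHypergeometric a b c) := by
  set Φ := koebePullback a (ordinaryHypergeometric a b c)
  have hΦ : HasTaylorCoeffsAt Φ (fun n => iteratedDeriv n Φ 0 / n.factorial) 0 := .of_analyticAt
    (analyticAt_koebePullback a (hasTaylorCoeffsAt_ordinaryHypergeometric a b c).analyticAt)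
  set k : ℕ → ℂ := fun n => iteratedDeriv n Φ 0 / n.factorial
  have hrec : ∀ n : ℕ, k (n + 2) =
      ((n + 1) * (4 * b - 2 * c) + (4 * a * b - 2 * a * c)) / ((n + 2) * (n + 1 + c)) * k (n + 1) +
      (2 * a + n) * (2 * a + 1 - c + n) / ((n + 2) * (n + 1 + c)) * k n := fun n => by
    have hcoeff := congrFun (koebeOperator_coeff_eq_zero a b hc hΦ) (n + 1)
    simp only [ThreeTermOperator.coeff_succ, koebeOperator, Pi.zero_apply] at hcoeff
    have hn : (n + 2 : ℂ) ≠ 0 := by exact_mod_cast (n + 1).succ_ne_zero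
    have hcn : (n + 1 + c : ℂ) ≠ 0 := by
      simpa [add_comm, add_assoc, add_left_comm] using add_natCast_ne_zero hc (n + 1)
    field_simp
    linear_combination -hcoeff
  obtain ⟨K, hK, hKk⟩ := HasTaylorCoeffsAt.exists_of_bound (a := k) (c := 0) fun ρ hρ =>
    exists_bound_of_recurrence (tendsto_koebeOperator_ratio₁ a b c)
      (tendsto_koebeOperator_ratio₀ a c) hrec ρ.2 (by
        simpa using pow_lt_one₀ ρ.2 hρ two_ne_zero)
  exact ⟨K, hK, hKk.eventuallyEq hΦ⟩

/-- The inverse of `koebeMap`, on the plane cut along `[1, ∞)`. -/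
noncomputable def koebeInverse (z : ℂ) : ℂ :=
  (1 - Complex.sqrt (1 - z)) / (1 + Complex.sqrt (1 - z))

theorem sqrt_re_pos {z : ℂ} (hz : z ∈ Complex.slitPlane) : 0 < (Complex.sqrt z).re := by
  rw [Complex.sqrt, Complex.cpow_inv_two_re, Real.sqrt_pos]
  have hle : -‖z‖ ≤ z.re := neg_le_of_abs_le (Complex.abs_re_le_norm z)
  have hne : -‖z‖ ≠ z.re := fun h =>
    Complex.mem_slitPlane_iff_not_le_zero.1 hz (Complex.re_eq_neg_norm.1 h.symm)
  linarith [hle.lt_of_ne hne]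

theorem one_add_ne_zero_of_re_pos {s : ℂ} (hs : 0 < s.re) : 1 + s ≠ 0 := fun h => by
  have := congrArg Complex.re h
  simp only [Complex.add_re, Complex.one_re, Complex.zero_re] at this
  linarith

theorem norm_one_sub_div_one_add_lt_one {s : ℂ} (hs : 0 < s.re) : ‖(1 - s) / (1 + s)‖ < 1 := by
  rw [norm_div, div_lt_one (norm_pos_iff.2 (one_add_ne_zero_of_re_pos hs))]
  refine lt_of_pow_lt_pow_left₀ 2 (norm_nonneg _) ?_
  rw [Complex.sq_norm, Complex.sq_norm, Complex.normSq_apply, Complex.normSq_apply]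
  simp only [Complex.sub_re, Complex.sub_im, Complex.add_re, Complex.add_im, Complex.one_re,
    Complex.one_im]
  nlinarith

theorem mapsTo_koebeInverse : Set.MapsTo koebeInverse gaussDomain (Metric.ball 0 1) :=
  fun _ hz => mem_ball_zero_iff.2 (norm_one_sub_div_one_add_lt_one (sqrt_re_pos hz))

theorem koebeMap_koebeInverse {z : ℂ} (hz : z ∈ gaussDomain) : koebeMap (koebeInverse z) = z := by
  have hne := one_add_ne_zero_of_re_pos (sqrt_re_pos hz)
  have hsq : Complex.sqrt (1 - z) ^ 2 = 1 - z := Complex.cpow_ofNat_inv_pow _ 2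
  rw [koebeMap, koebeInverse]
  field_simp
  linear_combination -4 * hsq

theorem differentiableOn_koebeInverse : DifferentiableOn ℂ koebeInverse gaussDomain := by
  have hsqrt : DifferentiableOn ℂ (fun z : ℂ => Complex.sqrt (1 - z)) gaussDomain :=
    Complex.differentiableOn_sqrt.comp (by fun_prop) fun _ hz => hz
  exact (hsqrt.const_sub 1).div (hsqrt.const_add 1) fun z hz =>
    one_add_ne_zero_of_re_pos (sqrt_re_pos hz)

theorem exists_isGaussHypergeometric (a b : ℂ) {c : ℂ} (hc : ∀ n : ℕ, c ≠ -(n : ℂ)) :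
    ∃ F : ℂ → ℂ, IsGaussHypergeometric a b c F ∧
      HasTaylorCoeffsAt F (ordinaryHypergeometricCoefficient a b c) 0 := by
  obtain ⟨K, hK, hKeq⟩ := exists_continuation_koebePullback a b hc
  let F : ℂ → ℂ := fun z => (1 + koebeInverse z) ^ (2 * a) * K (koebeInverse z)
  have hslit : ∀ z ∈ gaussDomain, 1 + koebeInverse z ∈ Complex.slitPlane := fun z hz =>
    one_add_mem_slitPlane (mapsTo_koebeInverse hz)
  have hdiff : DifferentiableOn ℂ F gaussDomain :=
    ((differentiableOn_koebeInverse.const_add 1).cpow_const hslit).fun_mul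
      (hK.comp differentiableOn_koebeInverse mapsTo_koebeInverse)
  have hinv : Tendsto koebeInverse (𝓝 0) (𝓝 0) := by
    simpa [koebeInverse] using (differentiableOn_koebeInverse.differentiableAt
      gaussDomain_mem_nhds_zero).continuousAt.tendsto
  have heq : ordinaryHypergeometric a b c =ᶠ[𝓝 0] F := by
    filter_upwards [hinv.eventually hKeq, gaussDomain_mem_nhds_zero] with z hz hzg
    simp only [F]
    rw [hz, koebePullback, koebeMap_koebeInverse hzg, ← mul_assoc,
      ← Complex.cpow_add _ _ (Complex.slitPlane_ne_zero (hslit z hzg))]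
    simp
  have hF := (hasTaylorCoeffsAt_ordinaryHypergeometric a b c).congr heq
  exact ⟨F, .of_hasTaylorCoeffsAt hc hdiff hF, hF⟩

end GaussHypergeometric

section HeunEquation

variable {α β γ δ ε t q : ℂ}

/-- Heun's operator `z(z - 1)(z - t)∂² + (γ(z - 1)(z - t) + δz(z - t) + εz(z - 1))∂ + αβz - q`,
which is the left-hand side of Heun's equation with the denominators cleared, at the base
point `0`. -/
def heunOperator (α β γ δ ε t q : ℂ) : ThreeTermOperator ℂ where
  p₃ := 1
  p₂ := -(1 + t)
  p₁ := t
  r₂ := γ + δ + ε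
  r₁ := -(γ * (1 + t) + δ * t + ε)
  r₀ := γ * t
  s₁ := α * β
  s₀ := -q

/-- Heun's operator at the base point `t`. -/
def heunOperatorAtParam (α β γ δ ε t q : ℂ) : ThreeTermOperator ℂ where
  p₃ := 1
  p₂ := 2 * t - 1
  p₁ := t * (t - 1)
  r₂ := γ + δ + ε
  r₁ := γ * (t - 1) + δ * t + ε * (2 * t - 1)
  r₀ := ε * t * (t - 1)
  s₁ := α * β
  s₀ := α * β * t - q

theorem heunOperatorAtParam_apply (y : ℂ → ℂ) :
    (heunOperatorAtParam α β γ δ ε t q).apply t y = (heunOperator α β γ δ ε t q).apply 0 y := by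
  funext z
  simp only [ThreeTermOperator.apply, heunOperator, heunOperatorAtParam]
  ring

theorem heunOperator_apply_eq_mul_heunLHS {y : ℂ → ℂ} {z : ℂ} (h0 : z ≠ 0) (h1 : z ≠ 1)
    (ht : z ≠ t) : (heunOperator α β γ δ ε t q).apply 0 y z =
      z * (z - 1) * (z - t) * heunLHS α β γ δ ε t q y z := by
  have h1' := sub_ne_zero.2 h1
  have ht' := sub_ne_zero.2 ht
  simp only [ThreeTermOperator.apply, heunOperator, heunLHS]
  field_simp
  ring

/-- Heun's equation has a solution which is holomorphic and does not vanish at `t`. -/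
def HasRegularHeunSolutionAt (α β γ δ ε t q : ℂ) : Prop :=
  ∃ f : ℂ → ℂ, AnalyticAt ℂ f t ∧ f t ≠ 0 ∧ ∀ᶠ z in 𝓝[≠] t, heunLHS α β γ δ ε t q f z = 0

theorem HasRegularHeunSolutionAt.exists_coeff_eq_zero
    (h : HasRegularHeunSolutionAt α β γ δ ε t q) (ht0 : t ≠ 0) (ht1 : t ≠ 1) :
    ∃ a : ℕ → ℂ, a 0 ≠ 0 ∧ (heunOperatorAtParam α β γ δ ε t q).coeff a = 0 := by
  obtain ⟨f, hf, hft, hfz⟩ := h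
  have hT := HasTaylorCoeffsAt.of_analyticAt hf
  refine ⟨_, by rwa [← hT.apply_center],
    (ThreeTermOperator.eventually_apply_eq_zero_iff _ hT).1 ?_⟩
  refine (hT.apply _).analyticAt.frequently_zero_iff_eventually_zero.1 (Eventually.frequently ?_)
  filter_upwards [hfz, self_mem_nhdsWithin, nhdsWithin_le_nhds (isOpen_ne.mem_nhds ht0),
    nhdsWithin_le_nhds (isOpen_ne.mem_nhds ht1)] with z hz hzt hz0 hz1
  rw [heunOperatorAtParam_apply, heunOperator_apply_eq_mul_heunLHS hz0 hz1 hzt, hz, mul_zero]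

theorem hasTaylorCoeffsAt_pow {𝕜 : Type*} [NontriviallyNormedField 𝕜] (n : ℕ) (c : 𝕜) :
    HasTaylorCoeffsAt (fun z => z ^ n) (fun j => n.choose j * c ^ (n - j)) c := by
  rw [HasTaylorCoeffsAt.iff_hasSum]
  refine Eventually.of_forall fun z => ?_
  rw [add_comm c z, add_pow]
  convert hasSum_sum_of_ne_finset_zero (L := .unconditional ℕ)
    (f := fun j => z ^ j * (n.choose j * c ^ (n - j))) fun j hj => ?_ using 2
  · ring
  · rw [Nat.choose_eq_zero_of_lt (by simpa using hj), Nat.cast_zero, zero_mul, mul_zero]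

theorem eq_zero_of_sum_mul_choose_eq_zero {K : Type*} [Field K] {N : ℕ} (x : K)
    {l : Fin N → K} (h : ∀ n : ℕ, ∑ j, l j * (n.choose j * x ^ (n - j : ℕ)) = 0) : l = 0 := by
  suffices ∀ n (hn : n < N), l ⟨n, hn⟩ = 0 from funext fun j => this j j.2
  intro n
  induction n using Nat.strong_induction_on with
  | _ n ih =>
    intro hn
    rw [← h n, Finset.sum_eq_single ⟨n, hn⟩ (fun j _ hj => ?_) (by simp)]
    · simp
    · rcases lt_or_gt_of_ne (Fin.val_ne_of_ne hj) with hlt | hgt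
      · rw [show l j = 0 from ih j hlt j.2, zero_mul]
      · rw [Nat.choose_eq_zero_of_lt hgt, Nat.cast_zero, zero_mul, mul_zero]

theorem exists_polynomial_eval_eq_sum_choose {K : Type*} [Field K] [CharZero K] {N : ℕ} {x : K}
    (hx : x ≠ 0) {l : Fin N → K} (hl : l ≠ 0) :
    ∃ P : K[X], P ≠ 0 ∧
      ∀ n : ℕ, ∑ j, l j * (n.choose j * x ^ (n - j : ℕ)) = x ^ n * P.eval (n : K) := by
  let P : K[X] := ∑ j : Fin N, C (l j / x ^ (j : ℕ) / (j : ℕ).factorial) * descPochhammer K j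
  have hP : ∀ n : ℕ, ∑ j, l j * (n.choose j * x ^ (n - j : ℕ)) = x ^ n * P.eval (n : K) := by
    intro n
    simp only [P, eval_finsetSum, eval_mul, eval_C, Finset.mul_sum]
    refine Finset.sum_congr rfl fun j _ => ?_
    rw [descPochhammer_eval_eq_descFactorial, Nat.descFactorial_eq_factorial_mul_choose]
    have : ((j : ℕ).factorial : K) ≠ 0 := by exact_mod_cast (j : ℕ).factorial_ne_zero
    rcases le_or_gt (j : ℕ) n with hj | hj
    · obtain ⟨k, rfl⟩ := Nat.exists_eq_add_of_le hj
      rw [Nat.add_sub_cancel_left, Nat.cast_mul, pow_add]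
      field_simp
    · simp [Nat.choose_eq_zero_of_lt hj]
  refine ⟨P, fun h0 => hl (eq_zero_of_sum_mul_choose_eq_zero x fun n => ?_), hP⟩
  rw [hP, h0, eval_zero, mul_zero]

/-- `P` solves the difference equation adjoint to the recurrence by which Heun's operator at `0`
acts on power series coefficients, after the factors of the hypergeometric recurrence with the
parameters `α, β, γ` have been split off. -/
def IsHeunAdjointSolution (α β γ δ ε t q : ℂ) (P : ℂ[X]) : Prop :=
  ∀ n : ℕ, t * (n + α) * (n + β) * P.eval (n + 1 : ℂ) -
    (n * ((n - 1) * (1 + t) + γ * (1 + t) + δ * t + ε) + q) * P.eval (n : ℂ) +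
    n * (n - 1 + γ) * P.eval (n - 1 : ℂ) = 0

theorem heunOperator_apply_pow (hsum : γ + δ + ε = α + β + 1) (n : ℕ) :
    (heunOperator α β γ δ ε t q).apply 0 (fun z => z ^ n) =
      ((n + α) * (n + β)) • (fun z => z ^ (n + 1)) +
      (-(n * ((n - 1) * (1 + t) + γ * (1 + t) + δ * t + ε) + q)) • (fun z => z ^ n) +
      (t * n * (n - 1 + γ)) • (fun z => z ^ (n - 1)) := by
  funext z
  have h := (heunOperator α β γ δ ε t q).apply_sub_pow 0 n z
  simp only [sub_zero, heunOperator] at h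
  simp only [heunOperator, h, Pi.add_apply, Pi.smul_apply, smul_eq_mul]
  linear_combination n * z ^ (n + 1) * hsum

theorem exists_isHeunAdjointSolution {M : ℕ} (hε : ε = -M) (hsum : γ + δ + ε = α + β + 1)
    (ht0 : t ≠ 0) (ht1 : t ≠ 1) (h : HasRegularHeunSolutionAt α β γ δ ε t q) :
    ∃ P ≠ 0, IsHeunAdjointSolution α β γ δ ε t q P := by
  obtain ⟨a, ha0, ha⟩ := h.exists_coeff_eq_zero ht0 ht1
  obtain ⟨l, hl, hker⟩ := ThreeTermOperator.exists_functional_of_coeff_eq_zero _ (M := M)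
    (by simp only [heunOperatorAtParam, hε]; ring) ha0 ha
  obtain ⟨P, hP0, hP⟩ := exists_polynomial_eval_eq_sum_choose ht0 hl
  refine ⟨P, hP0, fun n => ?_⟩
  have hpow := fun k => hasTaylorCoeffsAt_pow k t
  have hT := (hpow n).apply (heunOperatorAtParam α β γ δ ε t q)
  rw [heunOperatorAtParam_apply, heunOperator_apply_pow hsum] at hT
  have hzero : (n + α) * (n + β) * (t ^ (n + 1) * P.eval ((n + 1 : ℕ) : ℂ)) +
      -(n * ((n - 1) * (1 + t) + γ * (1 + t) + δ * t + ε) + q) * (t ^ n * P.eval (n : ℂ)) +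
      t * n * (n - 1 + γ) * (t ^ (n - 1) * P.eval ((n - 1 : ℕ) : ℂ)) = 0 := by
    simp only [← hP, Finset.mul_sum, ← Finset.sum_add_distrib]
    rw [← hker fun j => n.choose j * t ^ (n - j), hT.unique ((((hpow _).const_smul _).add
      ((hpow _).const_smul _)).add ((hpow _).const_smul _))]
    refine Finset.sum_congr rfl fun j _ => ?_
    simp only [Pi.add_apply, Pi.smul_apply, smul_eq_mul]
    ring
  rcases n with _ | n
  · push_cast at hzero ⊢
    simp only [zero_add] at hzero ⊢
    linear_combination hzero
  · apply mul_left_cancel₀ (pow_ne_zero (n + 1) ht0)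
    push_cast [Nat.add_sub_cancel] at hzero ⊢
    rw [add_sub_cancel_right] at hzero ⊢
    linear_combination hzero

theorem IsHeunAdjointSolution.heunOperator_coeff_eq_zero {P : ℂ[X]}
    (hP : IsHeunAdjointSolution α β γ δ ε t q P) (hsum : γ + δ + ε = α + β + 1) {g : ℕ → ℂ}
    (hg : (hypergeometricOperator α β γ).coeff g = 0) :
    (heunOperator α β γ δ ε t q).coeff (fun n => P.eval (n : ℂ) * g n) = 0 := by
  have hrec : ∀ n : ℕ, (n + 1) * (n + γ) * g (n + 1) - (n + α) * (n + β) * g n = 0 := fun n => by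
    rw [← hypergeometricOperator_coeff, hg, Pi.zero_apply]
  ext n
  rcases n with _ | n
  · have h0 := hrec 0
    have hP0 := hP 0
    simp only [ThreeTermOperator.coeff_zero, heunOperator, Pi.zero_apply]
    push_cast at h0 hP0 ⊢
    simp only [zero_add] at h0 hP0
    linear_combination t * P.eval 1 * h0 + g 0 * hP0
  · have h1 := hrec (n + 1)
    have hPn := hP (n + 1)
    simp only [ThreeTermOperator.coeff_succ, heunOperator, Pi.zero_apply]
    push_cast at h1 hPn ⊢
    rw [add_sub_cancel_right, add_assoc (n : ℂ) 1 1, one_add_one_eq_two] at hPn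
    linear_combination t * P.eval (n + 2 : ℂ) * h1 - P.eval (n : ℂ) * hrec n + g (n + 1) * hPn +
      n * P.eval (n : ℂ) * g n * hsum

end HeunEquation

section ContiguousFunctions

theorem ascPochhammer_eval_add_natCast_mul {R : Type*} [CommSemiring R] (a : R) (k n : ℕ) :
    (ascPochhammer R k).eval (n + a) * (ascPochhammer R n).eval a =
      (ascPochhammer R k).eval a * (ascPochhammer R n).eval (a + k) := by
  have h₁ := congrArg (eval a) (ascPochhammer_mul R n k)
  have h₂ := congrArg (eval a) (ascPochhammer_mul R k n)
  simp only [eval_mul, eval_comp, eval_add, eval_X, eval_natCast] at h₁ h₂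
  rw [h₂, add_comm k n, ← h₁, add_comm (n : R) a, mul_comm]

theorem ascPochhammer_eval_mul_ordinaryHypergeometricCoefficient {𝕜 : Type*} [Field 𝕜]
    (a b c : 𝕜) (k n : ℕ) :
    (ascPochhammer 𝕜 k).eval (n + a) * ordinaryHypergeometricCoefficient a b c n =
      (ascPochhammer 𝕜 k).eval a * ordinaryHypergeometricCoefficient (a + k) b c n := by
  simp only [ordinaryHypergeometricCoefficient]
  linear_combination ((n.factorial : 𝕜)⁻¹ * (ascPochhammer 𝕜 n).eval b *
    ((ascPochhammer 𝕜 n).eval c)⁻¹) * ascPochhammer_eval_add_natCast_mul a k n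

/-- The shifted rising factorials `(X + a)(X + a + 1)⋯(X + a + k - 1)`, by which multiplication of
hypergeometric coefficients raises the parameter `a`. -/
noncomputable def ascPochhammerSequence {K : Type*} [Field K] (a : K) : Polynomial.Sequence K where
  elems' k := taylor a (ascPochhammer K k)
  degree_eq' k := by
    rw [degree_taylor, degree_eq_natDegree (monic_ascPochhammer K k).ne_zero,
      ascPochhammer_natDegree]

theorem ascPochhammerSequence_eval {K : Type*} [Field K] (a x : K) (k : ℕ) :
    (ascPochhammerSequence a k).eval x = (ascPochhammer K k).eval (x + a) :=
  taylor_eval a (ascPochhammer K k) x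

theorem span_range_ascPochhammerSequence {K : Type*} [Field K] (a : K) :
    Submodule.span K (Set.range (ascPochhammerSequence a)) = ⊤ :=
  (ascPochhammerSequence a).span fun k =>
    isUnit_iff_ne_zero.2 (leadingCoeff_ne_zero.2 ((ascPochhammerSequence a).ne_zero k))

theorem one_sub_mem_doublySlitPlane {z : ℂ} (hz : z ∈ doublySlitPlane) :
    1 - z ∈ doublySlitPlane :=
  ⟨hz.2, by simpa using hz.1⟩

theorem IsHypergeometricSolution.comp_one_sub {φ : ℂ → ℂ} (h : IsHypergeometricSolution φ) :
    IsHypergeometricSolution fun z => φ (1 - z) := by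
  obtain ⟨a, b, c, F, hF, h⟩ := h
  refine ⟨a, b, c, F, hF, ?_⟩
  rcases h with h | h | h | h
  · exact Or.inr (Or.inr (Or.inl fun z hz => h _ (one_sub_mem_doublySlitPlane hz)))
  · exact Or.inr (Or.inr (Or.inr fun z hz => h _ (one_sub_mem_doublySlitPlane hz)))
  · exact Or.inl fun z hz => by simpa using h _ (one_sub_mem_doublySlitPlane hz)
  · exact Or.inr (Or.inl fun z hz => by simpa using h _ (one_sub_mem_doublySlitPlane hz))

/-- The finite linear combinations of standard solutions of hypergeometric equations. -/
def hypergeometricSpan : Submodule ℂ (ℂ → ℂ) :=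
  Submodule.span ℂ {φ | IsHypergeometricSolution φ}

theorem comp_one_sub_mem_hypergeometricSpan {y : ℂ → ℂ} (hy : y ∈ hypergeometricSpan) :
    (fun z => y (1 - z)) ∈ hypergeometricSpan := by
  suffices hypergeometricSpan ≤ hypergeometricSpan.comap (LinearMap.funLeft ℂ ℂ (1 - ·)) from
    this hy
  exact Submodule.span_le.2 fun φ hφ => Submodule.subset_span hφ.comp_one_sub

/-- The Taylor coefficients at `0` of those elements of `hypergeometricSpan` which are holomorphic
on the plane cut along `[1, ∞)`. -/
def hypergeometricTaylor : Submodule ℂ (ℕ → ℂ) where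
  carrier := {a | ∃ y ∈ hypergeometricSpan, DifferentiableOn ℂ y gaussDomain ∧
    HasTaylorCoeffsAt y a 0}
  zero_mem' := ⟨0, zero_mem _, differentiableOn_const 0, HasTaylorCoeffsAt.zero⟩
  add_mem' := by
    rintro _ _ ⟨y, hy, hd, ht⟩ ⟨y', hy', hd', ht'⟩
    exact ⟨y + y', add_mem hy hy', hd.add hd', ht.add ht'⟩
  smul_mem' := by
    rintro k _ ⟨y, hy, hd, ht⟩
    exact ⟨k • y, Submodule.smul_mem _ k hy, hd.const_smul k, ht.const_smul k⟩

theorem shiftRight_mem_hypergeometricTaylor {m : ℕ} (a b : ℂ) {c : ℂ}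
    (hc : ∀ n : ℕ, c ≠ -(n : ℂ)) (hm : m = 0 ∨ c - 1 = m) :
    shiftRight m (ordinaryHypergeometricCoefficient a b c) ∈ hypergeometricTaylor := by
  obtain ⟨F, hF, hFt⟩ := exists_isGaussHypergeometric a b hc
  refine ⟨_, Submodule.subset_span ⟨a, b, c, F, hF, ?_⟩, DifferentiableOn.mul (by fun_prop) hF.2.1,
    hFt.sub_pow_mul m⟩
  rcases hm with rfl | hm
  · exact Or.inl fun z _ => by simp
  · exact Or.inr (Or.inl fun z _ => by simp [hm])

theorem shiftRight_eval_mul_mem_hypergeometricTaylor {m : ℕ} (a b : ℂ) {c : ℂ}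
    (hc : ∀ n : ℕ, c ≠ -(n : ℂ)) (hm : m = 0 ∨ c - 1 = m) (Q : ℂ[X]) :
    shiftRight m (fun n => Q.eval (n : ℂ) * ordinaryHypergeometricCoefficient a b c n) ∈
      hypergeometricTaylor := by
  let multiply : ℂ[X] →ₗ[ℂ] (ℕ → ℂ) :=
    LinearMap.pi fun n => (LinearMap.mulRight ℂ (ordinaryHypergeometricCoefficient a b c n)).comp
      (leval (n : ℂ))
  suffices ⊤ ≤ hypergeometricTaylor.comap ((shiftRight m).comp multiply) from
    this (Submodule.mem_top (x := Q))
  rw [← span_range_ascPochhammerSequence a, Submodule.span_le]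
  rintro _ ⟨k, rfl⟩
  have hk : multiply (ascPochhammerSequence a k) =
      (ascPochhammer ℂ k).eval a • ordinaryHypergeometricCoefficient (a + k) b c := by
    ext n
    exact (congrArg (· * _) (ascPochhammerSequence_eval a n k)).trans
      (ascPochhammer_eval_mul_ordinaryHypergeometricCoefficient a b c k n)
  rw [SetLike.mem_coe, Submodule.mem_comap, LinearMap.comp_apply, hk, map_smul]
  exact Submodule.smul_mem _ _ (shiftRight_mem_hypergeometricTaylor _ b hc hm)

end ContiguousFunctions

section LocalSolutions

theorem exists_hypergeometric_exponent {K : Type*} [Field K] [CharZero K] (c : K) :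
    ∃ m : ℕ, (m = 0 ∨ c + m - 1 = 0) ∧ ∀ n : ℕ, c + 2 * m ≠ -(n : K) := by
  by_cases h : ∃ k : ℕ, c = -(k : K)
  · obtain ⟨k, rfl⟩ := h
    refine ⟨k + 1, Or.inr (by push_cast; ring), fun n hn => ?_⟩
    have : ((k + n + 2 : ℕ) : K) = 0 := by
      push_cast at hn ⊢
      linear_combination hn
    rw [Nat.cast_eq_zero] at this
    omega
  · push Not at h
    exact ⟨0, Or.inl rfl, by simpa using h⟩

theorem hypergeometricOperator_coeff_shiftRight {𝕜 : Type*} [NontriviallyNormedField 𝕜]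
    {a b c : 𝕜} {m : ℕ} (hm : m = 0 ∨ c + m - 1 = 0) {u : ℕ → 𝕜}
    (hu : (hypergeometricOperator (a + m) (b + m) (c + 2 * m)).coeff u = 0) :
    (hypergeometricOperator a b c).coeff (shiftRight m u) = 0 := by
  have hm' : m * (c + m - 1) = 0 := by
    rcases hm with rfl | hm
    · rw [Nat.cast_zero, zero_mul]
    · rw [hm, mul_zero]
  ext n
  rw [hypergeometricOperator_coeff, Pi.zero_apply]
  rcases lt_trichotomy (n + 1) m with hn | rfl | hn
  · rw [shiftRight_of_lt hn, shiftRight_of_lt (by omega), mul_zero, mul_zero, sub_zero]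
  · rw [shiftRight_of_lt n.lt_succ_self]
    push_cast at hm'
    linear_combination shiftRight (n + 1) u (n + 1) * hm'
  · obtain ⟨k, rfl⟩ := Nat.exists_eq_add_of_le' (Nat.lt_succ_iff.1 hn)
    have hk := congrFun hu k
    rw [hypergeometricOperator_coeff, Pi.zero_apply] at hk
    rw [add_right_comm, shiftRight_add, shiftRight_add]
    push_cast
    linear_combination hk + u (k + 1) * hm'

theorem exists_eventually_le_norm_eval {𝕜 : Type*} [RCLike 𝕜] {P : 𝕜[X]} (hP : P ≠ 0) :
    ∃ k > 0, ∀ᶠ n : ℕ in atTop, k ≤ ‖P.eval (n : 𝕜)‖ := by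
  rcases le_or_gt P.degree 0 with h | h
  · rw [eq_C_of_degree_le_zero h] at hP ⊢
    exact ⟨‖P.coeff 0‖, norm_pos_iff.2 (by simpa using hP), Eventually.of_forall fun n => by simp⟩
  · have hcast : Tendsto (fun n : ℕ => ‖(n : 𝕜)‖) atTop atTop := by
      simpa using tendsto_natCast_atTop_atTop (R := ℝ)
    exact ⟨1, one_pos, (P.tendsto_norm_atTop h hcast).eventually_ge_atTop 1⟩

theorem not_summable_two_pow_mul_ordinaryHypergeometricCoefficient {a b c : ℂ}
    (ha : ∀ n : ℕ, a ≠ -(n : ℂ)) (hb : ∀ n : ℕ, b ≠ -(n : ℂ)) (hc : ∀ n : ℕ, c ≠ -(n : ℂ)) :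
    ¬Summable fun n => (2 : ℂ) ^ n * ordinaryHypergeometricCoefficient a b c n := by
  intro hsum
  have hradius : ((2 : NNReal) : ENNReal) ≤ (ordinaryHypergeometricSeries ℂ a b c).radius := by
    refine FormalMultilinearSeries.le_radius_of_summable_norm _ (hsum.norm.congr fun n => ?_)
    rw [norm_mul, norm_pow, mul_comm, ordinaryHypergeometricSeries,
      FormalMultilinearSeries.ofScalars_norm]
    simp
  rw [ordinaryHypergeometricSeries_radius_eq_one ℂ a b c fun k => ⟨?_, ?_, ?_⟩] at hradius
  · exact absurd hradius (by norm_num)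
  · exact fun h => ha k (by rw [h, neg_neg])
  · exact fun h => hb k (by rw [h, neg_neg])
  · exact fun h => hc k (by rw [h, neg_neg])

theorem HasTaylorCoeffsAt.not_differentiable_of_hypergeometric {a b c : ℂ}
    (ha : ∀ n : ℕ, a ≠ -(n : ℂ)) (hb : ∀ n : ℕ, b ≠ -(n : ℂ)) (hc : ∀ n : ℕ, c ≠ -(n : ℂ))
    {Q : ℂ[X]} (hQ : Q ≠ 0) {m : ℕ} {Y : ℂ → ℂ} (hY : HasTaylorCoeffsAt Y
      (shiftRight m fun n => Q.eval (n : ℂ) * ordinaryHypergeometricCoefficient a b c n) 0) :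
    ¬Differentiable ℂ Y := by
  intro hd
  have hsum := (hY.hasSum_of_differentiableOn (r := 3) hd.differentiableOn (z := 2)
    (by simp; norm_num)).summable
  simp only [sub_zero] at hsum
  rw [← summable_nat_add_iff m] at hsum
  simp only [shiftRight_add, pow_add, mul_right_comm _ ((2 : ℂ) ^ m)] at hsum
  rw [summable_mul_right_iff (pow_ne_zero m two_ne_zero)] at hsum
  obtain ⟨k, hk, hkQ⟩ := exists_eventually_le_norm_eval hQ
  refine not_summable_two_pow_mul_ordinaryHypergeometricCoefficient ha hb hc
    (summable_of_isBigO_nat hsum.norm (Asymptotics.IsBigO.of_bound k⁻¹ ?_))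
  filter_upwards [hkQ] with n hn
  rw [norm_norm, inv_mul_eq_div, le_div_iff₀ hk]
  calc ‖(2 : ℂ) ^ n * ordinaryHypergeometricCoefficient a b c n‖ * k
      ≤ ‖(2 : ℂ) ^ n * ordinaryHypergeometricCoefficient a b c n‖ * ‖Q.eval (n : ℂ)‖ := by gcongr
    _ = ‖(2 : ℂ) ^ n * (Q.eval (n : ℂ) * ordinaryHypergeometricCoefficient a b c n)‖ := by
      rw [← norm_mul, mul_assoc, mul_comm (Q.eval _)]

theorem exists_recurrence_solution_mem_hypergeometricTaylor {α β : ℂ}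
    (hα : ∀ n : ℕ, α ≠ -(n : ℂ)) (hβ : ∀ n : ℕ, β ≠ -(n : ℂ)) (γ : ℂ) :
    ∃ g, (hypergeometricOperator α β γ).coeff g = 0 ∧ ∀ P : ℂ[X], P ≠ 0 →
      (fun n : ℕ => P.eval (n : ℂ) * g n) ∈ hypergeometricTaylor ∧
      ∀ Y, HasTaylorCoeffsAt Y (fun n : ℕ => P.eval (n : ℂ) * g n) 0 → ¬Differentiable ℂ Y := by
  obtain ⟨m, hm, hc⟩ := exists_hypergeometric_exponent γ
  have hadd : ∀ {x : ℂ}, (∀ n : ℕ, x ≠ -(n : ℂ)) → ∀ n : ℕ, x + m ≠ -(n : ℂ) := fun hx n hn =>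
    hx (n + m) (by push_cast; linear_combination hn)
  refine ⟨_, hypergeometricOperator_coeff_shiftRight hm
    (hypergeometricOperator_coeff_ordinaryHypergeometricCoefficient _ _ hc), fun P hP => ?_⟩
  have hshift : ∀ u : ℕ → ℂ, (fun n : ℕ => P.eval (n : ℂ) * shiftRight m u n) =
      shiftRight m fun n => (taylor (m : ℂ) P).eval (n : ℂ) * u n := by
    intro u
    ext n
    rcases lt_or_ge n m with hn | hn
    · rw [shiftRight_of_lt hn, shiftRight_of_lt hn, mul_zero]
    · obtain ⟨k, rfl⟩ := Nat.exists_eq_add_of_le' hn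
      rw [shiftRight_add, shiftRight_add, taylor_eval, Nat.cast_add]
  rw [hshift]
  refine ⟨shiftRight_eval_mul_mem_hypergeometricTaylor _ _ hc (hm.imp_right fun h => ?_) _,
    fun Y hY => hY.not_differentiable_of_hypergeometric (hadd hα) (hadd hβ) hc ?_⟩
  · linear_combination h
  · exact (map_ne_zero_iff _ (taylor_injective _)).2 hP

theorem isOpen_doublySlitPlane : IsOpen doublySlitPlane :=
  Complex.isOpen_slitPlane.inter isOpen_gaussDomain

theorem isPreconnected_gaussDomain : IsPreconnected gaussDomain := by
  have hslit := (Complex.starConvex_one_slitPlane.isPathConnected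
    Complex.one_mem_slitPlane).isConnected.isPreconnected
  convert hslit.image (fun z : ℂ => 1 - z) (by fun_prop) using 1
  ext z
  exact ⟨fun hz => ⟨1 - z, hz, sub_sub_cancel 1 z⟩, by rintro ⟨w, hw, rfl⟩; simpa [gaussDomain]⟩

theorem isPreconnected_doublySlitPlane : IsPreconnected doublySlitPlane := by
  have hslit : StarConvex ℝ ((1 / 2 : ℝ) : ℂ) Complex.slitPlane :=
    Complex.starConvex_ofReal_slitPlane (by norm_num)
  have hstar : StarConvex ℝ ((1 / 2 : ℝ) : ℂ) doublySlitPlane := by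
    intro z hz a b ha hb hab
    refine ⟨hslit hz.1 ha hb hab, ?_⟩
    have habc : (a : ℂ) + b = 1 := by exact_mod_cast hab
    convert hslit hz.2 ha hb hab using 1
    simp only [Complex.real_smul]
    push_cast
    linear_combination -habc
  refine (hstar.isPathConnected ⟨?_, ?_⟩).isConnected.isPreconnected
  · exact Complex.ofReal_mem_slitPlane.2 (by norm_num)
  · rw [← Complex.ofReal_one, ← Complex.ofReal_sub]
    exact Complex.ofReal_mem_slitPlane.2 (by norm_num)

theorem doublySlitPlane_diff_subset (t : ℂ) : doublySlitPlane \ {t} ⊆ {0, 1, t}ᶜ := by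
  rintro z ⟨⟨hz, hz'⟩, hzt⟩ (rfl | rfl | h)
  · exact Complex.zero_notMem_slitPlane hz
  · simp at hz'
  · exact hzt h

/-- A solution `y` of Heun's equation which is a combination of hypergeometric functions and extends
holomorphically to `Ω`, but not to an entire function. It is used with `Ω` the plane cut along
`[1, ∞)` or `(-∞, 0]`, where `y` is holomorphic at `0` or at `1`, respectively. -/
structure IsHypergeometricHeunSolution (α β γ δ ε t q : ℂ) (Ω : Set ℂ) (y : ℂ → ℂ) : Prop where
  mem_span : y ∈ hypergeometricSpan
  differentiableOn : DifferentiableOn ℂ y Ω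
  isHeunSolutionOn : IsHeunSolutionOn α β γ δ ε t q (doublySlitPlane \ {t}) y
  not_entire : ∀ Y, Differentiable ℂ Y → ¬Set.EqOn Y y Ω

variable {α β γ δ ε t q : ℂ}

theorem isHeunSolutionOn_of_eventually_heunOperator_apply_eq_zero {y : ℂ → ℂ}
    (hy : DifferentiableOn ℂ y gaussDomain)
    (h : ∀ᶠ z in 𝓝 0, (heunOperator α β γ δ ε t q).apply 0 y z = 0) :
    IsHeunSolutionOn α β γ δ ε t q (doublySlitPlane \ {t}) y := by
  refine ⟨hy.mono fun z hz => hz.1.2, fun z hz => ?_⟩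
  have hanalytic : AnalyticOnNhd ℂ ((heunOperator α β γ δ ε t q).apply 0 y) gaussDomain :=
    fun z hz => ThreeTermOperator.analyticAt_apply _
      (hy.analyticAt (isOpen_gaussDomain.mem_nhds hz))
  have hzero := hanalytic.eqOn_zero_of_preconnected_of_eventuallyEq_zero
    isPreconnected_gaussDomain (mem_of_mem_nhds gaussDomain_mem_nhds_zero) h hz.1.2
  have hz' := doublySlitPlane_diff_subset t hz
  simp only [Set.mem_compl_iff, Set.mem_insert_iff, Set.mem_singleton_iff, not_or] at hz'
  rw [heunOperator_apply_eq_mul_heunLHS hz'.1 hz'.2.1 hz'.2.2] at hzero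
  exact (mul_eq_zero.1 hzero).resolve_left
    (mul_ne_zero (mul_ne_zero hz'.1 (sub_ne_zero.2 hz'.2.1)) (sub_ne_zero.2 hz'.2.2))

theorem exists_isHypergeometricHeunSolution_gaussDomain {M : ℕ} (hε : ε = -M)
    (hsum : γ + δ + ε = α + β + 1) (ht0 : t ≠ 0) (ht1 : t ≠ 1) (hα : ∀ n : ℕ, α ≠ -(n : ℂ))
    (hβ : ∀ n : ℕ, β ≠ -(n : ℂ)) (h : HasRegularHeunSolutionAt α β γ δ ε t q) :
    ∃ y, IsHypergeometricHeunSolution α β γ δ ε t q gaussDomain y := by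
  obtain ⟨P, hP0, hP⟩ := exists_isHeunAdjointSolution hε hsum ht0 ht1 h
  obtain ⟨g, hg, hgP⟩ := exists_recurrence_solution_mem_hypergeometricTaylor hα hβ γ
  obtain ⟨⟨y, hy, hyd, hyt⟩, hentire⟩ := hgP P hP0
  refine ⟨y, hy, hyd, ?_, fun Y hY hYy => hentire Y (hyt.congr ?_) hY⟩
  · exact isHeunSolutionOn_of_eventually_heunOperator_apply_eq_zero hyd
      ((ThreeTermOperator.eventually_apply_eq_zero_iff _ hyt).2
        (hP.heunOperator_coeff_eq_zero hsum hg))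
  · exact hYy.symm.eventuallyEq_of_mem gaussDomain_mem_nhds_zero

theorem deriv_deriv_comp_const_sub {𝕜 F : Type*} [NontriviallyNormedField 𝕜]
    [NormedAddCommGroup F] [NormedSpace 𝕜 F] (f : 𝕜 → F) (c x : 𝕜) :
    deriv (deriv fun z => f (c - z)) x = deriv (deriv f) (c - x) := by
  rw [funext (deriv_comp_const_sub f c), deriv.fun_neg, deriv_comp_const_sub, neg_neg]

theorem heunLHS_comp_one_sub (α β γ δ ε t q : ℂ) (y : ℂ → ℂ) (z : ℂ) :
    heunLHS α β γ δ ε t q (fun w => y (1 - w)) z =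
      heunLHS α β δ γ ε (1 - t) (α * β - q) y (1 - z) := by
  have h₀ : γ / (1 - z - 1) = -(γ / z) := by rw [← div_neg]; congr 1; ring
  have h₁ : δ / (1 - z) = -(δ / (z - 1)) := by rw [← div_neg, neg_sub]
  have ht : ε / (1 - z - (1 - t)) = -(ε / (z - t)) := by rw [← div_neg]; congr 1; ring
  have hr : (α * β * (1 - z) - (α * β - q)) / ((1 - z) * (1 - z - 1) * (1 - z - (1 - t))) =
      (α * β * z - q) / (z * (z - 1) * (z - t)) := by
    rw [← neg_div_neg_eq]
    congr 1 <;> ring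
  simp only [heunLHS, deriv_deriv_comp_const_sub, deriv_comp_const_sub, h₀, h₁, ht, hr]
  ring

theorem HasRegularHeunSolutionAt.reflect (h : HasRegularHeunSolutionAt α β γ δ ε t q) :
    HasRegularHeunSolutionAt α β δ γ ε (1 - t) (α * β - q) := by
  obtain ⟨f, hf, hft, hfz⟩ := h
  have hpunctured : Tendsto (fun z : ℂ => 1 - z) (𝓝[≠] (1 - t)) (𝓝[≠] t) := by
    have hcont : ContinuousAt (fun z : ℂ => 1 - z) (1 - t) := by fun_prop
    simpa using hcont.continuousWithinAt.tendsto_nhdsWithin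
      (s := {1 - t}ᶜ) (t := {t}ᶜ) fun z hz h =>
        hz (by rw [Set.mem_singleton_iff, ← h.out, sub_sub_cancel])
  refine ⟨fun z => f (1 - z), AnalyticAt.fun_comp (g := f) (by rwa [sub_sub_cancel]) (by fun_prop),
    by simpa using hft, ?_⟩
  filter_upwards [hpunctured.eventually hfz] with z hz
  rw [heunLHS_comp_one_sub, sub_sub_cancel, sub_sub_cancel, hz]

theorem IsHypergeometricHeunSolution.comp_one_sub {y : ℂ → ℂ}
    (h : IsHypergeometricHeunSolution α β δ γ ε (1 - t) (α * β - q) gaussDomain y) :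
    IsHypergeometricHeunSolution α β γ δ ε t q Complex.slitPlane fun z => y (1 - z) where
  mem_span := comp_one_sub_mem_hypergeometricSpan h.mem_span
  differentiableOn := h.differentiableOn.comp (by fun_prop) fun z hz => by simpa [gaussDomain]
  isHeunSolutionOn := by
    have hmem : ∀ z ∈ doublySlitPlane \ {t}, 1 - z ∈ doublySlitPlane \ {1 - t} := fun z hz =>
      ⟨one_sub_mem_doublySlitPlane hz.1, fun h => hz.2 (sub_right_injective h)⟩
    refine ⟨h.isHeunSolutionOn.1.comp (by fun_prop) hmem, fun z hz => ?_⟩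
    rw [heunLHS_comp_one_sub]
    exact h.isHeunSolutionOn.2 _ (hmem z hz)
  not_entire Y hY hYy := h.not_entire (fun z => Y (1 - z)) (hY.comp (by fun_prop)) fun z hz => by
    simpa using hYy (x := 1 - z) hz

theorem exists_isHypergeometricHeunSolution_slitPlane {M : ℕ} (hε : ε = -M)
    (hsum : γ + δ + ε = α + β + 1) (ht0 : t ≠ 0) (ht1 : t ≠ 1) (hα : ∀ n : ℕ, α ≠ -(n : ℂ))
    (hβ : ∀ n : ℕ, β ≠ -(n : ℂ)) (h : HasRegularHeunSolutionAt α β γ δ ε t q) :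
    ∃ y, IsHypergeometricHeunSolution α β γ δ ε t q Complex.slitPlane y := by
  obtain ⟨y, hy⟩ := exists_isHypergeometricHeunSolution_gaussDomain hε
    (by linear_combination hsum) (sub_ne_zero.2 ht1.symm) (by simpa using ht0) hα hβ h.reflect
  exact ⟨_, hy.comp_one_sub⟩

end LocalSolutions

section CauchyProblem

theorem eventually_eq_zero_of_second_order_ode {𝕜 : Type*} [NontriviallyNormedField 𝕜]
    [CompleteSpace 𝕜] [CharZero 𝕜] {y p r : 𝕜 → 𝕜} {z : 𝕜} (hy : AnalyticAt 𝕜 y z)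
    (hp : AnalyticAt 𝕜 p z) (hr : AnalyticAt 𝕜 r z)
    (h : ∀ᶠ w in 𝓝 z, deriv (deriv y) w + p w * deriv y w + r w * y w = 0)
    (h₀ : y z = 0) (h₁ : deriv y z = 0) : ∀ᶠ w in 𝓝 z, y w = 0 := by
  have horder₁ : analyticOrderAt (deriv y) z + 1 = analyticOrderAt y z := by
    simpa [h₀] using hy.analyticOrderAt_deriv_add_one
  have horder₂ : analyticOrderAt (deriv (deriv y)) z + 1 = analyticOrderAt (deriv y) z := by
    simpa [h₁] using hy.deriv.analyticOrderAt_deriv_add_one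
  have hode : deriv (deriv y) =ᶠ[𝓝 z] -(p * deriv y + r * y) := by
    filter_upwards [h] with w hw
    simp only [Pi.neg_apply, Pi.add_apply, Pi.mul_apply]
    linear_combination hw
  have hle : analyticOrderAt (deriv y) z ≤ analyticOrderAt (deriv (deriv y)) z := by
    rw [analyticOrderAt_congr hode, analyticOrderAt_neg]
    refine le_trans (le_min ?_ ?_) le_analyticOrderAt_add
    · rw [analyticOrderAt_mul hp hy.deriv]
      exact le_add_self
    · rw [analyticOrderAt_mul hr hy, ← horder₁]
      exact le_self_add.trans le_add_self
  have htop : analyticOrderAt (deriv (deriv y)) z = ⊤ := by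
    by_contra hne
    rw [← horder₂] at hle
    exact hle.not_gt ((ENat.lt_add_one_iff hne).2 le_rfl)
  rw [← analyticOrderAt_eq_top, ← horder₁, ← horder₂, htop, top_add, top_add]

variable {α β γ δ ε t q : ℂ} {U : Set ℂ} {f g y : ℂ → ℂ}

theorem IsHeunSolutionOn.mono {V : Set ℂ} (hy : IsHeunSolutionOn α β γ δ ε t q V y)
    (hUV : U ⊆ V) : IsHeunSolutionOn α β γ δ ε t q U y :=
  ⟨hy.1.mono hUV, fun z hz => hy.2 z (hUV hz)⟩

theorem IsHeunSolutionOn.const_smul (hy : IsHeunSolutionOn α β γ δ ε t q U y) (a : ℂ) :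
    IsHeunSolutionOn α β γ δ ε t q U (a • y) := by
  have hderiv : ∀ u : ℂ → ℂ, deriv (a • u) = a • deriv u := fun u =>
    funext fun z => deriv_const_smul_field a u
  refine ⟨hy.1.const_smul a, fun z hz => ?_⟩
  have hz := hy.2 z hz
  simp only [heunLHS, hderiv, Pi.smul_apply, smul_eq_mul] at hz ⊢
  linear_combination a * hz

theorem IsHeunSolutionOn.add (hU : IsOpen U) (hf : IsHeunSolutionOn α β γ δ ε t q U f)
    (hg : IsHeunSolutionOn α β γ δ ε t q U g) : IsHeunSolutionOn α β γ δ ε t q U (f + g) := by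
  refine ⟨hf.1.add hg.1, fun z hz => ?_⟩
  have hderiv : ∀ w ∈ U, deriv (f + g) w = deriv f w + deriv g w := fun w hw =>
    deriv_add (hf.1.differentiableAt (hU.mem_nhds hw)) (hg.1.differentiableAt (hU.mem_nhds hw))
  have hderiv₂ : deriv (deriv (f + g)) z = deriv (deriv f) z + deriv (deriv g) z := by
    rw [(Set.EqOn.eventuallyEq_of_mem hderiv (hU.mem_nhds hz)).deriv_eq]
    exact deriv_fun_add ((hf.1.deriv hU).differentiableAt (hU.mem_nhds hz))
      ((hg.1.deriv hU).differentiableAt (hU.mem_nhds hz))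
  have hfz := hf.2 z hz
  have hgz := hg.2 z hz
  simp only [heunLHS, hderiv₂, hderiv z hz, Pi.add_apply] at hfz hgz ⊢
  linear_combination hfz + hgz

theorem IsHeunSolutionOn.eqOn_zero (hU : IsOpen U) (hUc : IsPreconnected U)
    (hUs : U ⊆ {0, 1, t}ᶜ) (hy : IsHeunSolutionOn α β γ δ ε t q U y) {z : ℂ} (hz : z ∈ U)
    (h₀ : y z = 0) (h₁ : deriv y z = 0) : Set.EqOn y 0 U := by
  have hy' := hy.1.analyticOnNhd hU
  obtain ⟨hz0, hz1, hzt⟩ : z ≠ 0 ∧ z - 1 ≠ 0 ∧ z - t ≠ 0 := by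
    simpa [sub_eq_zero, not_or] using hUs hz
  have hp : AnalyticAt ℂ (fun z => γ / z + δ / (z - 1) + ε / (z - t)) z := by
    fun_prop (disch := assumption)
  have hr : AnalyticAt ℂ (fun z => (α * β * z - q) / (z * (z - 1) * (z - t))) z :=
    AnalyticAt.div (by fun_prop) (by fun_prop) (mul_ne_zero (mul_ne_zero hz0 hz1) hzt)
  exact hy'.eqOn_zero_of_preconnected_of_eventuallyEq_zero hUc hz
    (eventually_eq_zero_of_second_order_ode (hy' z hz) hp hr
      (eventually_of_mem (hU.mem_nhds hz) hy.2) h₀ h₁)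

theorem IsHeunSolutionOn.exists_eqOn_smul_add_smul (hU : IsOpen U) (hUc : IsPreconnected U)
    (hUs : U ⊆ {0, 1, t}ᶜ) (hf : IsHeunSolutionOn α β γ δ ε t q U f)
    (hg : IsHeunSolutionOn α β γ δ ε t q U g)
    (hfg : ∀ a b : ℂ, Set.EqOn (a • f + b • g) 0 U → a = 0 ∧ b = 0)
    (hy : IsHeunSolutionOn α β γ δ ε t q U y) : ∃ a b : ℂ, Set.EqOn y (a • f + b • g) U := by
  rcases U.eq_empty_or_nonempty with rfl | ⟨z, hz⟩
  · exact ⟨0, 0, Set.eqOn_empty _ _⟩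
  let cauchyData (u : ℂ → ℂ) : ℂ × ℂ := (u z, deriv u z)
  have hadd : ∀ {u v : ℂ → ℂ}, IsHeunSolutionOn α β γ δ ε t q U u →
      IsHeunSolutionOn α β γ δ ε t q U v → cauchyData (u + v) = cauchyData u + cauchyData v :=
    fun hu hv => Prod.ext rfl (deriv_add (hu.1.differentiableAt (hU.mem_nhds hz))
      (hv.1.differentiableAt (hU.mem_nhds hz)))
  have hsmul : ∀ (a : ℂ) (u : ℂ → ℂ), cauchyData (a • u) = a • cauchyData u := fun a u =>
    Prod.ext rfl (deriv_const_smul_field a u)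
  have huniq : ∀ {u : ℂ → ℂ}, IsHeunSolutionOn α β γ δ ε t q U u → cauchyData u = 0 →
      Set.EqOn u 0 U := fun hu h =>
    hu.eqOn_zero hU hUc hUs hz (congrArg Prod.fst h) (congrArg Prod.snd h)
  let L : ℂ × ℂ →ₗ[ℂ] ℂ × ℂ := (LinearMap.toSpanSingleton ℂ _ (cauchyData f)).coprod
    (LinearMap.toSpanSingleton ℂ _ (cauchyData g))
  have hcomb : ∀ a b : ℂ, IsHeunSolutionOn α β γ δ ε t q U (a • f + b • g) := fun a b =>
    (hf.const_smul a).add hU (hg.const_smul b)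
  have hL : ∀ a b : ℂ, L (a, b) = cauchyData (a • f + b • g) := fun a b => by
    simp [L, hadd (hf.const_smul a) (hg.const_smul b), hsmul]
  have hinj : Function.Injective L := by
    rw [injective_iff_map_eq_zero]
    rintro ⟨a, b⟩ hab
    exact Prod.ext_iff.2 (hfg a b (huniq (hcomb a b) (by rw [← hL, hab])))
  obtain ⟨⟨a, b⟩, hab⟩ := LinearMap.injective_iff_surjective.1 hinj (cauchyData y)
  have hdiff : Set.EqOn (y + (-1 : ℂ) • (a • f + b • g)) 0 U :=
    huniq (hy.add hU ((hcomb a b).const_smul (-1)))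
      (by rw [hadd hy ((hcomb a b).const_smul (-1)), hsmul, ← hL, hab, neg_one_smul,
        add_neg_cancel])
  rw [neg_one_smul, ← sub_eq_add_neg] at hdiff
  exact ⟨a, b, fun w hw => sub_eq_zero.1 (hdiff hw)⟩

end CauchyProblem

section Independence

theorem gaussDomain_union_slitPlane : gaussDomain ∪ Complex.slitPlane = Set.univ := by
  refine Set.eq_univ_of_forall fun z => ?_
  simp only [Set.mem_union, gaussDomain, Set.mem_ofPred_eq, Complex.mem_slitPlane_iff,
    Complex.sub_re, Complex.one_re, Complex.sub_im, Complex.one_im, zero_sub, ne_eq, neg_eq_zero]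
  by_cases him : z.im = 0
  · rcases le_or_gt z.re 0 with hre | hre
    · exact Or.inl (Or.inl (by linarith))
    · exact Or.inr (Or.inl hre)
  · exact Or.inr (Or.inr him)

theorem exists_differentiable_eqOn {f g : ℂ → ℂ} (hf : DifferentiableOn ℂ f gaussDomain)
    (hg : DifferentiableOn ℂ g Complex.slitPlane) (h : Set.EqOn f g doublySlitPlane) :
    ∃ Y : ℂ → ℂ, Differentiable ℂ Y ∧ Set.EqOn Y f gaussDomain ∧
      Set.EqOn Y g Complex.slitPlane := by
  classical
  have hYf : Set.EqOn (gaussDomain.piecewise f g) f gaussDomain := Set.piecewise_eqOn _ _ _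
  have hYg : Set.EqOn (gaussDomain.piecewise f g) g Complex.slitPlane := fun z hz => by
    by_cases hz' : z ∈ gaussDomain
    · rw [hYf hz', h ⟨hz, hz'⟩]
    · rw [Set.piecewise_eq_of_notMem _ _ _ hz']
  refine ⟨_, fun z => ?_, hYf, hYg⟩
  rcases gaussDomain_union_slitPlane.ge (Set.mem_univ z) with hz | hz
  · exact (hf.congr hYf).differentiableAt (isOpen_gaussDomain.mem_nhds hz)
  · exact (hg.congr hYg).differentiableAt (Complex.isOpen_slitPlane.mem_nhds hz)

variable {α β γ δ ε t q : ℂ} {f g : ℂ → ℂ}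

theorem IsHypergeometricHeunSolution.eq_zero_of_eqOn_doublySlitPlane
    (hf : IsHypergeometricHeunSolution α β γ δ ε t q gaussDomain f)
    (hg : IsHypergeometricHeunSolution α β γ δ ε t q Complex.slitPlane g) {a b : ℂ}
    (h : Set.EqOn (a • f + b • g) 0 doublySlitPlane) : a = 0 ∧ b = 0 := by
  obtain ⟨Y, hY, hYf, hYg⟩ := exists_differentiable_eqOn (f := a • f) (g := -b • g)
    (hf.differentiableOn.const_smul a) (hg.differentiableOn.const_smul (-b)) fun z hz => by
      simpa [add_eq_zero_iff_eq_neg] using h hz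
  constructor
  · by_contra ha
    refine hf.not_entire (a⁻¹ • Y) (hY.const_smul _) fun z hz => ?_
    rw [Pi.smul_apply, hYf hz, Pi.smul_apply, inv_smul_smul₀ ha]
  · by_contra hb
    refine hg.not_entire ((-b)⁻¹ • Y) (hY.const_smul _) fun z hz => ?_
    rw [Pi.smul_apply, hYg hz, Pi.smul_apply, inv_smul_smul₀ (neg_ne_zero.2 hb)]

theorem IsHypergeometricHeunSolution.eq_zero_of_eqOn
    (hf : IsHypergeometricHeunSolution α β γ δ ε t q gaussDomain f)
    (hg : IsHypergeometricHeunSolution α β γ δ ε t q Complex.slitPlane g) {U : Set ℂ}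
    (hU : IsOpen U) (hne : U.Nonempty) (hUs : U ⊆ doublySlitPlane) {a b : ℂ}
    (h : Set.EqOn (a • f + b • g) 0 U) : a = 0 ∧ b = 0 := by
  obtain ⟨z, hz⟩ := hne
  have hanalytic : AnalyticOnNhd ℂ (a • f + b • g) doublySlitPlane :=
    (((hf.differentiableOn.mono fun w hw => hw.2).const_smul a).add
      ((hg.differentiableOn.mono fun w hw => hw.1).const_smul b)).analyticOnNhd
      isOpen_doublySlitPlane
  exact hf.eq_zero_of_eqOn_doublySlitPlane hg
    (hanalytic.eqOn_zero_of_preconnected_of_eventuallyEq_zero isPreconnected_doublySlitPlane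
      (hUs hz) (h.eventuallyEq_of_mem (hU.mem_nhds hz)))

end Independence

theorem exists_finite_family_of_mem_span {K V : Type*} [DivisionRing K] [AddCommGroup V]
    [Module K V] {S : Set V} {v w : V} (hv : v ∈ Submodule.span K S)
    (hw : w ∈ Submodule.span K S) :
    ∃ (N : ℕ) (φ : Fin N → V), (∀ i, φ i ∈ S) ∧
      v ∈ Submodule.span K (Set.range φ) ∧ w ∈ Submodule.span K (Set.range φ) := by
  classical
  obtain ⟨T₁, hT₁, hv⟩ := Submodule.mem_span_finite_of_mem_span hv
  obtain ⟨T₂, hT₂, hw⟩ := Submodule.mem_span_finite_of_mem_span hw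
  let T := T₁ ∪ T₂
  have hT : (T : Set V) ⊆ S := by simp [T, hT₁, hT₂]
  have hrange : Set.range (fun i => (T.equivFin.symm i : V)) = T :=
    (T.equivFin.symm.surjective.range_comp Subtype.val).trans Subtype.range_coe
  refine ⟨T.card, fun i => T.equivFin.symm i, fun i => hT (T.equivFin.symm i).2, ?_, ?_⟩ <;>
    rw [hrange]
  · exact Submodule.span_mono (by simp [T]) hv
  · exact Submodule.span_mono (by simp [T]) hw

theorem mainTheorem8_general {α β γ δ t q : ℂ} {ε : ℤ}
    (hsum : γ + δ + (ε : ℂ) = α + β + 1) (ht0 : t ≠ 0) (ht1 : t ≠ 1) (hε : ε ≤ 0)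
    (hα : ∀ n : ℕ, α ≠ -(n : ℂ)) (hβ : ∀ n : ℕ, β ≠ -(n : ℂ))
    (h : HasRegularHeunSolutionAt α β γ δ ε t q) :
    ∃ (N : ℕ) (φ : Fin N → ℂ → ℂ), (∀ i, IsHypergeometricSolution (φ i)) ∧
      ∀ (U : Set ℂ) (y : ℂ → ℂ), IsOpen U → IsPreconnected U →
        U ⊆ doublySlitPlane \ {t} → IsHeunSolutionOn α β γ δ (ε : ℂ) t q U y →
        ∃ C : Fin N → ℂ, ∀ z ∈ U, y z = ∑ i, C i * φ i z := by
  obtain ⟨M, hM⟩ := Int.eq_ofNat_of_zero_le (neg_nonneg.2 hε)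
  have hM : (ε : ℂ) = -M := neg_eq_iff_eq_neg.1 (by exact_mod_cast hM)
  obtain ⟨f, hf⟩ := exists_isHypergeometricHeunSolution_gaussDomain hM hsum ht0 ht1 hα hβ h
  obtain ⟨g, hg⟩ := exists_isHypergeometricHeunSolution_slitPlane hM hsum ht0 ht1 hα hβ h
  obtain ⟨N, φ, hφ, hfφ, hgφ⟩ := exists_finite_family_of_mem_span hf.mem_span hg.mem_span
  refine ⟨N, φ, hφ, fun U y hU hUc hUs hy => ?_⟩
  rcases U.eq_empty_or_nonempty with rfl | hne
  · exact ⟨0, fun z hz => hz.elim⟩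
  obtain ⟨a, b, hab⟩ := (hf.isHeunSolutionOn.mono hUs).exists_eqOn_smul_add_smul hU hUc
    (hUs.trans (doublySlitPlane_diff_subset t)) (hg.isHeunSolutionOn.mono hUs)
    (fun a b => hf.eq_zero_of_eqOn hg hU hne fun z hz => (hUs hz).1) hy
  obtain ⟨C, hC⟩ := Submodule.mem_span_range_iff_exists_fun ℂ |>.1
    (add_mem (Submodule.smul_mem _ a hfφ) (Submodule.smul_mem _ b hgφ))
  exact ⟨C, fun z hz => by rw [hab hz, ← hC, Finset.sum_apply]; rfl⟩

theorem mainTheorem8 (α β γ δ t q : ℂ) (ε : ℤ)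
    (hsum : γ + δ + (ε : ℂ) = α + β + 1) (ht0 : t ≠ 0) (ht1 : t ≠ 1)
    (hε : ε ≤ 0)
    (hα : ∀ n : ℤ, α ≠ (n : ℂ)) (hβ : ∀ n : ℤ, β ≠ (n : ℂ))
    (hβγ : ∀ n : ℤ, β - γ ≠ (n : ℂ)) (hβδ : ∀ n : ℤ, β - δ ≠ (n : ℂ))
    (happ : HeunApparentAt α β γ δ ε t q) :
    ∃ (N : ℕ) (φ : Fin N → ℂ → ℂ), (∀ i, IsHypergeometricSolution (φ i)) ∧
      ∀ (U : Set ℂ) (y : ℂ → ℂ), IsOpen U → IsPreconnected U →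
        U ⊆ doublySlitPlane \ {t} → IsHeunSolutionOn α β γ δ (ε : ℂ) t q U y →
        ∃ C : Fin N → ℂ, ∀ z ∈ U, y z = ∑ i, C i * φ i z := by
  obtain ⟨f, -, hf, hft, -, -, hfs, -⟩ := happ
  exact mainTheorem8_general hsum ht0 ht1 hε (fun n => by exact_mod_cast hα (-n))
    (fun n => by exact_mod_cast hβ (-n)) ⟨f, hf, hft, hfs⟩
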